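/- Let $n\ge 1$ and $p\ge 2$ be integers. Let $B_n(p,2)$ be the extended Coxeter diagram that is a path with vertices $1,\dots,n$, in which the edge $\{1,2\}$ has label $m_{12}=4$, all other edges have label $3$ (and $m_{ij}=2$ for non-adjacent $i\neq j$), vertex $1$ has label $p_1=p$, and all other vertices have label $p_i=2$. Let $G$ be its Shephard group: the group generated by $S=\{s_1,\dots,s_n\}$ with relations $s_i^{p_i}=1$ and $s_is_js_i\cdots=s_js_is_j\cdots$ ($m_{ij}$ factors on each side). For $T\subseteq S$ let $G_T\le G$ be the subgroup generated by $T$. Let $\Delta$ be the spherical $(n-1)$-simplex that is a fundamental chamber of the underlying Coxeter group on the unit sphere. Thus its walls $1,\dots,n$ meet pairwise at dihedral angles $\pi/m_{ij}$; its vertex labelled $s_i$ is the one opposite to wall $i$; and $\sigma_T$ denotes the face spanned by the vertices labelled by $T$. Let $\widehat\Theta(B_n(p,2))$ be the development of the simple complex of groups over $\Delta$ with local group $G_{S\setminus T}$ at $\sigma_T$: its points are the pairs $(x,gG_{S\setminus T})$, where $x\in\Delta$ lies in the open face of $\sigma_T$ and $g\in G$; its closed chambers are the sets $g\Delta=\{(x,gG_{S\setminus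 T})\}$, and its closed simplices are their faces $g\sigma_T$, $T\ne\varnothing$. Give it the Moussong metric, that is, the intrinsic length metric in which each chamber is isometric to $\Delta$ (the infimum of the lengths of strings of points in which consecutive points lie in a common chamber, with value $\infty$ if there is no such string). Let $J$ be the $n$-fold spherical join of a set of $p$ points (at mutual distance $\infty$). For $n\ge2$ its points are the formal sums $\sum_i w_ix_i$ with $w_i\ge 0$, $\sum_i w_i^2=1$, $x_i$ in the $i$-th copy of the set (and $x_i$ disregarded when $w_i=0$), and its distance $d\in[0,\pi]$ satisfies $\cos d(\sum w_ix_i,\sum w'_ix'_i)=\sum_i w_iw'_i\cos(\min\{\pi,d(x_i,x'_i)\})$; for $n=1$ it is the set of $p$ points itself. Its cells are the all-right spherical simplices spanned by choices of at most one point from each copy of the set. The simplices of its barycentric subdivision are the spherical convex hulls of the barycenters of the members of nonempty chains of (nonempty) cells. Then there is a bijection from $\widehat\Theta(B_n(p,2))$ onto $J$ that is an isometry and under which the closed simplices of $\widehat\Theta(B_n(p,2))$ correspond exactly to the closed simplices of the barycentric subdivision of $J$. Moreover, $\widehat\Theta(B_n(p,2))$ is a $\mathrm{CAT}(1)$ space.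 -/

import Mathlib

open scoped ENNReal

noncomputable section

/-! ### Extended Coxeter diagrams and Shephard groups -/

/-- An extended Coxeter diagram on the vertex set `I`: edge labels `m i j` (with `m i j = 2` when
`i ≠ j` are not joined by an edge) and vertex labels `p i ≥ 2`. As in Mathlib's `CoxeterMatrix`,
the value `0` stands for the label `∞`, both for edges and for vertices. -/
structure ExtendedCoxeterDiagram (I : Type) where
  m : CoxeterMatrix I
  p : I → ℕ
  p_ne_one : ∀ i, p i ≠ 1
  p_eq_of_odd : ∀ i j, Odd (m i j) → p i = p j

/-- `prod(a, b; m)`: the alternating product `abab⋯` with `m` factors. -/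
def altProd {G : Type} [Group G] (a b : G) (m : ℕ) : G :=
  if Even m then (a * b) ^ (m / 2) else (a * b) ^ ((m - 1) / 2) * a

namespace ExtendedCoxeterDiagram

variable {I : Type}

/-- The relators of the Shephard group. A label `0` (that is, `∞`) gives a trivial relator. -/
def relators (Γ : ExtendedCoxeterDiagram I) : Set (FreeGroup I) :=
  {r | (∃ i, r = FreeGroup.of i ^ Γ.p i) ∨
    ∃ i j, r = altProd (FreeGroup.of i) (FreeGroup.of j) (Γ.m i j) *
      (altProd (FreeGroup.of j) (FreeGroup.of i) (Γ.m i j))⁻¹}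

/-- The Shephard group `G_Γ`, given by its presentation. -/
abbrev ShephardGroup (Γ : ExtendedCoxeterDiagram I) : Type := PresentedGroup Γ.relators

/-- The standard parabolic subgroup `G_T`, generated by the `s_i` with `i ∈ T`. -/
def parabolic (Γ : ExtendedCoxeterDiagram I) (T : Set I) : Subgroup Γ.ShephardGroup :=
  Subgroup.closure ((fun i => (PresentedGroup.of i : Γ.ShephardGroup)) '' T)

/-! ### The spherical simplex of the underlying Coxeter diagram -/

variable [Fintype I]

/-- The canonical bilinear form of the Coxeter group `W_Γ` on `ℝ^I`, determined by
`B(e_i, e_j) = - cos (π / m_ij)`. It is positive definite if `W_Γ` is finite. -/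
def cosForm (Γ : ExtendedCoxeterDiagram I) (x y : I → ℝ) : ℝ :=
  ∑ i, ∑ j, x i * y j * (-Real.cos (Real.pi / (Γ.m i j : ℝ)))

/-- `B(x, e_i)`: the `i`-th wall is the zero set of this functional. -/
def wall [DecidableEq I] (Γ : ExtendedCoxeterDiagram I) (x : I → ℝ) (i : I) : ℝ :=
  Γ.cosForm x (Pi.single i 1)

/-- The simplex `Δ_Γ` with its Moussong shape: the intersection of the unit sphere of `B` with the
fundamental chamber of `W_Γ`. It is the spherical simplex whose `i`-th and `j`-th walls meet at the
dihedral angle `π / m_ij`. Its vertex with label `s_i` is the one opposite to the `i`-th wall. -/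
def Simplex [DecidableEq I] (Γ : ExtendedCoxeterDiagram I) : Type :=
  {x : I → ℝ // Γ.cosForm x x = 1 ∧ ∀ i, 0 ≤ Γ.wall x i}

/-- The spherical distance in the simplex `Δ_Γ`. -/
def simplexDist [DecidableEq I] (Γ : ExtendedCoxeterDiagram I) (x y : Γ.Simplex) : ℝ :=
  Real.arccos (Γ.cosForm x.1 y.1)

variable [DecidableEq I]

/-- The local group at the open face `σ_T` of `Δ_Γ` containing `x`, where `T` is the set of `i` such
that `x` is not on the `i`-th wall: it is the parabolic subgroup generated by `S \ T`. -/
def localGroup (Γ : ExtendedCoxeterDiagram I) (x : Γ.Simplex) : Subgroup Γ.ShephardGroup :=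
  Γ.parabolic {i | Γ.wall x.1 i = 0}

/-! ### The complex `Θ̂(Γ)` with the Moussong metric -/

/-- The points of `Θ̂(Γ)`, the development of the simple complex of groups over `Δ_Γ` with local
group `G_{S \ T}` at the face `σ_T`: a point is a point `x` of `Δ_Γ` together with a coset of the
local group at `x`. -/
def ThetaHat (Γ : ExtendedCoxeterDiagram I) : Type :=
  Σ x : Γ.Simplex, Γ.ShephardGroup ⧸ Γ.localGroup x

/-- The closed chamber `g Δ_Γ` of `Θ̂(Γ)`. -/
def chamber (Γ : ExtendedCoxeterDiagram I) (g : Γ.ShephardGroup) : Set Γ.ThetaHat :=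
  {z | z.2 = QuotientGroup.mk g}

/-- The closed simplex `g σ_T` of `Θ̂(Γ)`. -/
def face (Γ : ExtendedCoxeterDiagram I) (g : Γ.ShephardGroup) (T : Set I) : Set Γ.ThetaHat :=
  {z | z ∈ Γ.chamber g ∧ ∀ i, i ∉ T → Γ.wall z.1.1 i = 0}

/-- The (nonempty, closed) simplices of `Θ̂(Γ)`. -/
def IsFace (Γ : ExtendedCoxeterDiagram I) (A : Set Γ.ThetaHat) : Prop :=
  ∃ (g : Γ.ShephardGroup) (T : Set I), T.Nonempty ∧ A = Γ.face g T

/-- The points `z 0, …, z k` form a string: consecutive points lie in a common closed chamber. -/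
def IsString (Γ : ExtendedCoxeterDiagram I) (k : ℕ) (z : ℕ → Γ.ThetaHat) : Prop :=
  ∀ l < k, ∃ g, z l ∈ Γ.chamber g ∧ z (l + 1) ∈ Γ.chamber g

/-- The length of the string `z 0, …, z k`, measured by the spherical distance in the chambers. -/
def stringLength (Γ : ExtendedCoxeterDiagram I) (k : ℕ) (z : ℕ → Γ.ThetaHat) : ℝ≥0∞ :=
  ∑ l ∈ Finset.range k, ENNReal.ofReal (Γ.simplexDist (z l).1 (z (l + 1)).1)

/-- The intrinsic distance of the piecewise spherical complex `Θ̂(Γ)`: the infimum of the lengths of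
the strings from `x` to `y` (`∞` if there is none). -/
instance (Γ : ExtendedCoxeterDiagram I) : EDist Γ.ThetaHat where
  edist x y := ⨅ (k : ℕ) (z : ℕ → Γ.ThetaHat) (_ : z 0 = x ∧ z k = y ∧ Γ.IsString k z),
    Γ.stringLength k z

end ExtendedCoxeterDiagram

/-- The diagram `B_n(p, 2)`: a path with vertices `0, …, n - 1`, where the edge from `0` to `1` has
label `4`, the other edges have label `3`, the vertex `0` has label `p` and the other vertices have
label `2`. -/
def diagramB (n p : ℕ) (hp : 2 ≤ p) : ExtendedCoxeterDiagram (Fin n) where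
  m :=
    { M := Matrix.of fun i j : Fin n =>
        if i = j then 1
        else if (i : ℕ) + 1 = j ∨ (j : ℕ) + 1 = i then
          (if (i : ℕ) = 0 ∨ (j : ℕ) = 0 then 4 else 3)
        else 2
      isSymm := by
        ext i j
        simp only [Matrix.transpose_apply, Matrix.of_apply, eq_comm (a := j) (b := i),
          or_comm (a := (j : ℕ) + 1 = i), or_comm (a := (j : ℕ) = 0)]
      diagonal := by simp
      off_diagonal := by
        intro i j hij
        simp only [Matrix.of_apply, if_neg hij]
        split_ifs <;> decide }
  p := fun i => if (i : ℕ) = 0 then p else 2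
  p_ne_one := by
    intro i
    split_ifs <;> omega
  p_eq_of_odd := by
    intro i j h
    by_cases hij : i = j
    · rw [hij]
    · simp only [Matrix.of_apply, if_neg hij] at h
      have h4 : ¬ Odd 4 := by decide
      have h2 : ¬ Odd 2 := by decide
      split_ifs at h ⊢ <;> simp_all

/-! ### Spherical joins -/

/-- The points of the `n`-fold spherical join `X * ⋯ * X`: formal combinations `∑ wt i • pt i` with
`wt i ≥ 0` and `∑ (wt i)² = 1`, where the point `pt i` of the `i`-th factor is only recorded if
its weight is not zero. -/
@[ext]
structure SphericalJoin (n : ℕ) (X : Type) where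
  wt : Fin n → ℝ
  pt : Fin n → Option X
  wt_nonneg : ∀ i, 0 ≤ wt i
  sum_sq : ∑ i, wt i ^ 2 = 1
  pt_eq_none : ∀ i, pt i = none ↔ wt i = 0

namespace SphericalJoin

variable {n : ℕ} {X : Type}

/-- `cos (min (d(a, b), π))` (and `0` if one of the points is not recorded). -/
def cosDist [EDist X] : Option X → Option X → ℝ
  | some a, some b => Real.cos (min (edist a b) (ENNReal.ofReal Real.pi)).toReal
  | _, _ => 0

/-- The distance in `X` of two recorded points. -/
def optDist [EDist X] : Option X → Option X → ℝ≥0∞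
  | some a, some b => edist a b
  | _, _ => 0

/-- The distance of the `n`-fold spherical join. For `n ≥ 2` it is the number `d` in `[0, π]` with
`cos d(x, y) = ∑ i, wt_i(x) wt_i(y) cos (min (d(x_i, y_i), π))`. The one-fold join of `X` is `X`
itself, with the distance of `X`. -/
instance [EDist X] : EDist (SphericalJoin n X) where
  edist x y :=
    if n = 1 then ⨆ i, optDist (x.pt i) (y.pt i)
    else ENNReal.ofReal (Real.arccos (∑ i, x.wt i * y.wt i * cosDist (x.pt i) (y.pt i)))

/-! #### The barycentric subdivision

A cell of the `n`-fold join of a discrete set `X` is an all-right spherical simplex whose vertices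
are points of distinct factors. It is described by the partial function `c` that gives its vertex
in the `i`-th factor, if there is one. -/

/-- The index set of the vertices of the cell `c`. -/
def supp (c : Fin n → Option X) : Finset (Fin n) := Finset.univ.filter fun i => c i ≠ none

/-- `c` is a face of `c'`. -/
def IsFaceOf (c c' : Fin n → Option X) : Prop := ∀ i, c i = none ∨ c i = c' i

/-- The closed cell described by `c`. -/
def cell (c : Fin n → Option X) : Set (SphericalJoin n X) := {z | IsFaceOf z.pt c}

/-- The `i`-th weight of the barycenter of the cell `c`. -/
def baryWt (c : Fin n → Option X) (i : Fin n) : ℝ :=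
  if c i = none then 0 else 1 / Real.sqrt (supp c).card

/-- The simplex of the barycentric subdivision given by a flag `F` of cells: the spherical convex
hull of the barycenters of the members of `F`, within the largest cell of `F`. -/
def barySimplex (F : Finset (Fin n → Option X)) : Set (SphericalJoin n X) :=
  {z | (∃ c ∈ F, z ∈ cell c) ∧
    ∃ a : (Fin n → Option X) → ℝ, (∀ c, 0 ≤ a c) ∧ ∀ i, z.wt i = ∑ c ∈ F, a c * baryWt c i}

/-- `A` is a (nonempty, closed) simplex of the barycentric subdivision of the join. -/
def IsBarySimplex (A : Set (SphericalJoin n X)) : Prop :=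
  ∃ F : Finset (Fin n → Option X), F.Nonempty ∧ (∀ c ∈ F, (supp c).Nonempty) ∧
    (∀ c ∈ F, ∀ c' ∈ F, IsFaceOf c c' ∨ IsFaceOf c' c) ∧ A = barySimplex F

end SphericalJoin

/-- A set of `p` points, as a zero-dimensional complex: the distance of two distinct points
is `∞`. -/
def PointSet (p : ℕ) : Type := Fin p

instance (p : ℕ) : EDist (PointSet p) where
  edist a b := by classical exact if a = b then 0 else ⊤

/-! ### CAT(1) spaces -/

/-- `c` restricts to a geodesic `[0, ℓ] → X` from `x` to `y`. -/
def IsGeodesic {X : Type} [EDist X] (x y : X) (ℓ : ℝ) (c : ℝ → X) : Prop :=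
  0 ≤ ℓ ∧ c 0 = x ∧ c ℓ = y ∧
    ∀ s ∈ Set.Icc 0 ℓ, ∀ t ∈ Set.Icc 0 ℓ, edist (c s) (c t) = ENNReal.ofReal |s - t|

/-- `u` and `v` are points of the unit sphere `S²` at spherical distance `r`. -/
def SphereDist (u v : EuclideanSpace ℝ (Fin 3)) (r : ℝ) : Prop :=
  ‖u‖ = 1 ∧ ‖v‖ = 1 ∧ InnerProductGeometry.angle u v = r

/-- `X` is a CAT(1) space: the distance is an (extended) metric, points at distance less than `π`
are joined by a geodesic, and in a geodesic triangle of perimeter less than `2π` the distance of a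
point `x` of the side `[p, q]` and a point `y` of the side `[p, r]` is at most the distance of the
comparison points `x'`, `y'` in a comparison triangle `p' q' r'` in the unit sphere `S²`. (Any two
distinct sides of a triangle have a common vertex, which can be taken as `p`.) -/
structure IsCAT1 (X : Type) [EDist X] : Prop where
  edist_eq_zero_iff : ∀ x y : X, edist x y = 0 ↔ x = y
  edist_comm : ∀ x y : X, edist x y = edist y x
  edist_triangle : ∀ x y z : X, edist x z ≤ edist x y + edist y z
  exists_geodesic : ∀ x y : X, edist x y < ENNReal.ofReal Real.pi →
    ∃ (ℓ : ℝ) (c : ℝ → X), IsGeodesic x y ℓ c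
  comparison : ∀ (p q r : X) (a b e : ℝ) (cpq cpr cqr : ℝ → X),
    IsGeodesic p q a cpq → IsGeodesic p r b cpr → IsGeodesic q r e cqr →
    a + b + e < 2 * Real.pi →
    ∀ p' q' r' : EuclideanSpace ℝ (Fin 3),
      SphereDist p' q' a → SphereDist p' r' b → SphereDist q' r' e →
    ∀ s ∈ Set.Icc 0 a, ∀ t ∈ Set.Icc 0 b, ∀ x' y' : EuclideanSpace ℝ (Fin 3),
      SphereDist p' x' s → SphereDist x' q' (a - s) →
      SphereDist p' y' t → SphereDist y' r' (b - t) →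
      edist (cpq s) (cpr t) ≤ ENNReal.ofReal (InnerProductGeometry.angle x' y')

end

/-!
# `Θ̂(B_n(p, 2))` is the barycentric subdivision of the `n`-fold join of `p` points

The simple roots of type `B_n` are `ε₀` and `(εᵢ - εᵢ₋₁) / √2`. In the coordinates of the `εᵢ`, the
simplex `Δ` is the set of unit vectors `0 ≤ y₀ ≤ ⋯ ≤ yₙ₋₁`, which is one simplex of the barycentric
subdivision of an all-right simplex: a cell of the join. The Shephard group acts on the join: `s₀`
rotates the `p` points of the first factor, and `sᵢ` exchanges the factors `i - 1` and `i`. Sending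
the point `x` of the chamber `gΔ` to the image of `x` under `g` gives the map `thetaToJoin`.

*Bijectivity.* Every point of the join is moved into the fundamental chamber by sorting its weights
and rotating its recorded points, and the sorted weights are determined by the point. It remains to
see that the stabilizer of a point of the fundamental chamber is the local group
(`mem_localGroup_of_act`); this includes the faithfulness of the action, and it is where the
presentation of the group is used. The braid relations show that the cosets of `⟨s₀, …, sₘ₋₁⟩` in
`⟨s₀, …, sₘ⟩` are represented by the elements `(s₁⋯sᵢ)⁻¹ s₀ᵃ (s₁⋯sₘ)` (`BraidB.exists_coset`). Such
an element moves the coordinate `m` to the coordinate `i` and rotates it by `a`; if its coset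
contains an element of the stabilizer, this forces it to be a product of generators that fix the
point, and one concludes by induction on `m`.

*Simplices.* The vertices of the chamber `gΔ` go to the barycenters of the members of a flag of
cells, and the coefficients of a point with respect to these are the increments of its sorted
weights (`image_face`). Every flag arises in this way: sort the coordinates by the number of
members of the flag in which they occur (`isFace_iff`).

*Distances.* For a choice of a point `cᵢ` in each factor there is a folding of the join onto the
unit sphere of `ℝⁿ`, which changes the sign of the `i`-th weight unless the `i`-th point is `cᵢ`.
Foldings do not increase distances, and preserve the distances from the points of the cell with
vertices `cᵢ`. Hence the triangle inequality of the join follows from that of the sphere, and the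
distance in the join is at most the length of any string in `Θ̂`. Conversely, two points of the
join lie in an apartment, a sphere subdivided by the walls `uᵢ = 0` and `uᵢ = ± uⱼ`; cutting a
segment at a wall that separates its endpoints, and repeating this, gives a string of the length of
the segment (`joined_apartment`). For `n = 1` both spaces are discrete.

*CAT(1).* Let `m` be a point of a geodesic `[x, y]` of the join. The equality case of the triangle
inequality shows that the recorded points of `m` are among those of `x` and `y`; so a folding
centred at a cell containing `m` can be chosen to be isometric on `{x, m, y}`. It preserves the
distance of `m` from any further point `q`, and increases neither `d(q, x)` nor `d(q, y)`. As the
image of `m` is a nonnegative combination of the images of `x` and `y`, this gives the comparison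
inequality for a vertex and a point of the opposite side (`sin_mul_joinCos_le`); applying it twice
gives the comparison inequality for two points of two sides (`comparison`).
-/

noncomputable section

/-! ### Spherical geometry -/

section Sphere

variable {V : Type*} [NormedAddCommGroup V] [InnerProductSpace ℝ V]

open InnerProductGeometry

theorem angle_eq_arccos_inner {u v : V} (hu : ‖u‖ = 1) (hv : ‖v‖ = 1) :
    angle u v = Real.arccos (inner ℝ u v) := by
  rw [angle, hu, hv, mul_one, div_one]

/-- The point of a spherical segment at distance `s` from `x`, as a combination of the endpoints. -/
theorem sin_smul_of_angle_add_angle {x m y : V} (hx : ‖x‖ = 1) (hm : ‖m‖ = 1) (hy : ‖y‖ = 1)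
    {a s : ℝ} (hxm : angle x m = s) (hmy : angle m y = a - s) (hxy : angle x y = a) :
    Real.sin a • m = Real.sin (a - s) • x + Real.sin s • y := by
  have h1 : inner ℝ x m = Real.cos s := by rw [inner_eq_cos_angle_of_norm_eq_one hx hm, hxm]
  have h2 : inner ℝ m y = Real.cos (a - s) := by
    rw [inner_eq_cos_angle_of_norm_eq_one hm hy, hmy]
  have h3 : inner ℝ x y = Real.cos a := by rw [inner_eq_cos_angle_of_norm_eq_one hx hy, hxy]
  have h1' : inner ℝ m x = Real.cos s := by rw [real_inner_comm, h1]
  have h2' : inner ℝ y m = Real.cos (a - s) := by rw [real_inner_comm, h2]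
  have h3' : inner ℝ y x = Real.cos a := by rw [real_inner_comm, h3]
  have hx1 : inner ℝ x x = (1 : ℝ) := inner_self_eq_one_of_norm_eq_one hx
  have hm1 : inner ℝ m m = (1 : ℝ) := inner_self_eq_one_of_norm_eq_one hm
  have hy1 : inner ℝ y y = (1 : ℝ) := inner_self_eq_one_of_norm_eq_one hy
  rw [← sub_eq_zero, ← inner_self_eq_zero (𝕜 := ℝ)]
  simp only [inner_sub_left, inner_sub_right, inner_add_left, inner_add_right,
    real_inner_smul_left, real_inner_smul_right, h1, h2, h3, h1', h2', h3', hx1, hm1, hy1,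
    Real.sin_sub, Real.cos_sub]
  have ha := Real.sin_sq_add_cos_sq a
  have hs := Real.sin_sq_add_cos_sq s
  generalize Real.sin a = A at *
  generalize Real.cos a = B at *
  generalize Real.sin s = C at *
  generalize Real.cos s = D at *
  clear h1 h2 h3 h1' h2' h3' hx1 hm1 hy1 hx hm hy hxm hmy hxy
  grind

end Sphere

namespace SphericalJoin

variable {n p : ℕ}

/-! ### The metric of the join -/

theorem cosDist_some_self (a : PointSet p) : cosDist (some a) (some a) = 1 := by
  simp [cosDist, edist]

theorem cosDist_some_of_ne {a b : PointSet p} (h : a ≠ b) :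
    cosDist (some a) (some b) = -1 := by
  simp [cosDist, edist, h, Real.pi_pos.le]

theorem cosDist_comm (a b : Option (PointSet p)) : cosDist a b = cosDist b a := by
  rcases a with _ | a <;> rcases b with _ | b <;> try rfl
  by_cases h : a = b
  · rw [h]
  · rw [cosDist_some_of_ne h, cosDist_some_of_ne (Ne.symm h)]

/-- The cosine of the distance of two points of the join. -/
def joinCos (x y : SphericalJoin n (PointSet p)) : ℝ :=
  ∑ i, x.wt i * y.wt i * cosDist (x.pt i) (y.pt i)

theorem joinCos_comm (x y : SphericalJoin n (PointSet p)) : joinCos x y = joinCos y x := by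
  simp only [joinCos, cosDist_comm (x.pt _), mul_comm (x.wt _)]

theorem edist_eq_arccos (hn : n ≠ 1) (x y : SphericalJoin n (PointSet p)) :
    edist x y = ENNReal.ofReal (Real.arccos (joinCos x y)) :=
  if_neg hn

/-! ### Folding the join onto a sphere -/

open Classical in
/-- The sign of the image of a recorded point when the point `a` is folded to the positive side
and all other points to the negative side. The value `-1` at `none` is immaterial, as it only occurs
with the weight zero. -/
def side (a : PointSet p) (o : Option (PointSet p)) : ℝ := if o = some a then 1 else -1

/-- The folding of the join onto the unit sphere of `ℝⁿ`, centred at the cell with vertices `c i`: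
the `i`-th coordinate is the `i`-th weight, with a positive sign if the `i`-th point is `c i`. -/
def fold (c : Fin n → PointSet p) (x : SphericalJoin n (PointSet p)) : EuclideanSpace ℝ (Fin n) :=
  WithLp.toLp 2 fun i => x.wt i * side (c i) (x.pt i)

theorem fold_apply (c : Fin n → PointSet p) (x : SphericalJoin n (PointSet p)) (i : Fin n) :
    fold c x i = x.wt i * side (c i) (x.pt i) := rfl

theorem side_some_self (a : PointSet p) : side a (some a) = 1 := by simp [side]

theorem side_of_ne {a : PointSet p} {o : Option (PointSet p)} (h : o ≠ some a) :
    side a o = -1 := by simp [side, h]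

theorem side_mul_self (a : PointSet p) (o : Option (PointSet p)) : side a o * side a o = 1 := by
  unfold side; split_ifs <;> norm_num

theorem inner_eq_sum (u v : EuclideanSpace ℝ (Fin n)) : inner ℝ u v = ∑ i, u i * v i := by
  simp [PiLp.inner_apply, mul_comm]

theorem inner_fold (c : Fin n → PointSet p) (x y : SphericalJoin n (PointSet p)) :
    inner ℝ (fold c x) (fold c y) =
      ∑ i, x.wt i * y.wt i * (side (c i) (x.pt i) * side (c i) (y.pt i)) := by
  rw [inner_eq_sum]
  refine Finset.sum_congr rfl fun i _ => ?_
  rw [fold_apply, fold_apply]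
  ring

theorem norm_fold (c : Fin n → PointSet p) (x : SphericalJoin n (PointSet p)) :
    ‖fold c x‖ = 1 := by
  have h : inner ℝ (fold c x) (fold c x) = (1 : ℝ) := by
    rw [inner_fold, ← x.sum_sq]
    refine Finset.sum_congr rfl fun i _ => ?_
    rw [side_mul_self, mul_one, sq]
  rw [real_inner_self_eq_norm_sq] at h
  exact (sq_eq_sq₀ (norm_nonneg _) zero_le_one).1 (by rw [h, one_pow])

theorem wt_eq_zero {x : SphericalJoin n (PointSet p)} {i : Fin n} (h : x.pt i = none) :
    x.wt i = 0 := (x.pt_eq_none i).1 h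

theorem term_le_fold (c : Fin n → PointSet p) (x y : SphericalJoin n (PointSet p)) (i : Fin n) :
    x.wt i * y.wt i * cosDist (x.pt i) (y.pt i) ≤
      x.wt i * y.wt i * (side (c i) (x.pt i) * side (c i) (y.pt i)) := by
  rcases hx : x.pt i with _ | a
  · simp [wt_eq_zero hx]
  rcases hy : y.pt i with _ | b
  · simp [wt_eq_zero hy]
  refine mul_le_mul_of_nonneg_left ?_ (mul_nonneg (x.wt_nonneg i) (y.wt_nonneg i))
  by_cases h : a = b
  · rw [h, cosDist_some_self, side_mul_self]
  · rw [cosDist_some_of_ne h]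
    unfold side
    split_ifs <;> norm_num

/-- Foldings do not increase distances. -/
theorem joinCos_le_inner_fold (c : Fin n → PointSet p) (x y : SphericalJoin n (PointSet p)) :
    joinCos x y ≤ inner ℝ (fold c x) (fold c y) := by
  rw [inner_fold]
  exact Finset.sum_le_sum fun i _ => term_le_fold c x y i

/-- No coordinate records distinct points of `x` and `y` that both differ from the vertex `c i` (and
would then be folded to the same side): this makes the folding isometric on `{x, y}`. -/
def Visible (c : Fin n → PointSet p) (x y : SphericalJoin n (PointSet p)) : Prop :=
  ∀ i, x.pt i = none ∨ y.pt i = none ∨ x.pt i = y.pt i ∨ x.pt i = some (c i) ∨ y.pt i = some (c i)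

theorem Visible.inner_fold_eq {c : Fin n → PointSet p} {x y : SphericalJoin n (PointSet p)}
    (h : Visible c x y) : inner ℝ (fold c x) (fold c y) = joinCos x y := by
  rw [inner_fold]
  refine Finset.sum_congr rfl fun i _ => ?_
  have hi := h i
  rcases hx : x.pt i with _ | a
  · simp [wt_eq_zero hx]
  rcases hy : y.pt i with _ | b
  · simp [wt_eq_zero hy]
  congr 1
  by_cases hab : a = b
  · rw [hab, cosDist_some_self, side_mul_self]
  · rw [cosDist_some_of_ne hab]
    simp only [hx, hy, reduceCtorEq, Option.some_inj, hab, false_or] at hi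
    rcases hi with hi | hi
    · rw [← hi, side_some_self, side_of_ne (by simpa using Ne.symm hab), one_mul]
    · rw [← hi, side_some_self, side_of_ne (by simpa using hab), mul_one]

open InnerProductGeometry in
theorem angle_fold_le (c : Fin n → PointSet p) (x y : SphericalJoin n (PointSet p)) :
    angle (fold c x) (fold c y) ≤ Real.arccos (joinCos x y) := by
  rw [angle_eq_arccos_inner (norm_fold c x) (norm_fold c y)]
  exact Real.arccos_le_arccos (joinCos_le_inner_fold c x y)

open InnerProductGeometry in
theorem Visible.angle_fold_eq {c : Fin n → PointSet p} {x y : SphericalJoin n (PointSet p)}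
    (h : Visible c x y) : angle (fold c x) (fold c y) = Real.arccos (joinCos x y) := by
  rw [angle_eq_arccos_inner (norm_fold c x) (norm_fold c y), h.inner_fold_eq]

/-- A cell with vertices `c i` that contains `x` and, as far as this leaves a choice, `y`. -/
def center [NeZero p] (x y : SphericalJoin n (PointSet p)) (i : Fin n) : PointSet p :=
  (x.pt i).getD ((y.pt i).getD (0 : Fin p))

theorem pt_eq_center [NeZero p] (x y : SphericalJoin n (PointSet p)) (i : Fin n) :
    x.pt i = none ∨ x.pt i = some (center x y i) := by
  unfold center
  rcases x.pt i <;> simp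

theorem visible_center [NeZero p] (x y z : SphericalJoin n (PointSet p)) :
    Visible (center x y) x z := fun i => by
  rcases pt_eq_center x y i with h | h <;> simp [h]

theorem joinCos_mem [NeZero p] (x y : SphericalJoin n (PointSet p)) :
    joinCos x y ∈ Set.Icc (-1) 1 := by
  rw [← (visible_center x x y).inner_fold_eq]
  exact ⟨neg_one_le_real_inner_of_norm_eq_one (norm_fold _ _) (norm_fold _ _),
    real_inner_le_one_of_norm_eq_one (norm_fold _ _) (norm_fold _ _)⟩

theorem arccos_joinCos_triangle [NeZero p] (x y z : SphericalJoin n (PointSet p)) :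
    Real.arccos (joinCos x z) ≤ Real.arccos (joinCos x y) + Real.arccos (joinCos y z) := by
  rw [← (visible_center x x z).angle_fold_eq]
  refine (InnerProductGeometry.angle_le_angle_add_angle _ (fold (center x x) y) _).trans ?_
  exact add_le_add (angle_fold_le _ _ _) (angle_fold_le _ _ _)

/-- A folding is injective relative to the points of the cell at which it is centred. -/
theorem fold_injective_at {c : Fin n → PointSet p} {x y : SphericalJoin n (PointSet p)}
    (hx : ∀ i, x.pt i = none ∨ x.pt i = some (c i)) (h : fold c x = fold c y) : x = y := by
  have key : ∀ i, x.wt i = y.wt i ∧ x.pt i = y.pt i := fun i => by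
    have hi : x.wt i * side (c i) (x.pt i) = y.wt i * side (c i) (y.pt i) := by
      rw [← fold_apply, h, fold_apply]
    have hx0 := x.wt_nonneg i
    have hy0 := y.wt_nonneg i
    rcases hx i with hxi | hxi
    · have hw := wt_eq_zero hxi
      rw [hw, zero_mul, eq_comm, mul_eq_zero] at hi
      have : y.wt i = 0 := by
        rcases hi with hi | hi
        · exact hi
        · have := side_mul_self (c i) (y.pt i)
          rw [hi] at this
          norm_num at this
      exact ⟨by rw [hw, this], by rw [hxi, (y.pt_eq_none i).2 this]⟩
    · have hpos : x.wt i ≠ 0 := fun h0 => by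
        rw [(x.pt_eq_none i).2 h0] at hxi
        cases hxi
      rw [hxi, side_some_self, mul_one] at hi
      by_cases hyc : y.pt i = some (c i)
      · rw [hyc, side_some_self, mul_one] at hi
        exact ⟨hi, by rw [hxi, hyc]⟩
      · rw [side_of_ne hyc] at hi
        exact absurd (by linarith) hpos
  ext1
  · exact funext fun i => (key i).1
  · exact funext fun i => (key i).2

theorem joinCos_self (x : SphericalJoin n (PointSet p)) : joinCos x x = 1 := by
  rw [← x.sum_sq]
  refine Finset.sum_congr rfl fun i _ => ?_
  rcases hx : x.pt i with _ | a
  · simp [wt_eq_zero hx]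
  · rw [cosDist_some_self, mul_one, sq]

theorem joinCos_eq_one_iff [NeZero p] (x y : SphericalJoin n (PointSet p)) :
    joinCos x y = 1 ↔ x = y := by
  refine ⟨fun h => ?_, fun h => h ▸ joinCos_self x⟩
  rw [← (visible_center x x y).inner_fold_eq,
    inner_eq_one_iff_of_norm_eq_one (norm_fold _ _) (norm_fold _ _)] at h
  exact fold_injective_at (pt_eq_center x x) h

/-! ### Apartments -/

/-- The apartment of the join spanned by the points `a i` and `b i` of the factors, as the image
of the unit sphere of `ℝⁿ`. -/
def apartment (a b : Fin n → PointSet p) (u : EuclideanSpace ℝ (Fin n)) (hu : ‖u‖ = 1) :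
    SphericalJoin n (PointSet p) where
  wt i := |u i|
  pt i := if u i = 0 then none else if 0 < u i then some (a i) else some (b i)
  wt_nonneg i := abs_nonneg _
  sum_sq := by
    have h : inner ℝ u u = (1 : ℝ) := by rw [real_inner_self_eq_norm_sq, hu, one_pow]
    rw [inner_eq_sum] at h
    simpa [sq] using h
  pt_eq_none i := by
    by_cases h : u i = 0
    · simp [h]
    · by_cases h' : 0 < u i <;> simp [h, h']

theorem joinCos_apartment {a b : Fin n → PointSet p} (hab : ∀ i, a i ≠ b i)
    {u v : EuclideanSpace ℝ (Fin n)} (hu : ‖u‖ = 1) (hv : ‖v‖ = 1) :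
    joinCos (apartment a b u hu) (apartment a b v hv) = inner ℝ u v := by
  rw [inner_eq_sum]
  refine Finset.sum_congr rfl fun i _ => ?_
  simp only [apartment]
  rcases eq_or_ne (u i) 0 with h | h
  · simp [h]
  rcases eq_or_ne (v i) 0 with h' | h'
  · simp [h']
  simp only [h, h', if_false]
  by_cases hu0 : 0 < u i <;> by_cases hv0 : 0 < v i
  · simp [hu0, hv0, abs_of_pos, cosDist_some_self]
  · simp [hu0, hv0, abs_of_pos, abs_of_nonpos (not_lt.1 hv0), cosDist_some_of_ne (hab i)]
  · simp [hu0, hv0, abs_of_pos, abs_of_nonpos (not_lt.1 hu0), cosDist_some_of_ne (hab i).symm]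
  · simp [hu0, hv0, abs_of_nonpos (not_lt.1 hv0), abs_of_nonpos (not_lt.1 hu0),
      cosDist_some_self]

theorem exists_ne_point (hp : 2 ≤ p) (a : PointSet p) : ∃ b : PointSet p, a ≠ b := by
  have : Nontrivial (Fin p) := Fin.nontrivial_iff_two_le.2 hp
  obtain ⟨b, hb⟩ := exists_ne (α := Fin p) a
  exact ⟨b, hb.symm⟩

/-- Any two points of the join lie in a common apartment. -/
theorem exists_apartment (hp : 2 ≤ p) (x y : SphericalJoin n (PointSet p)) :
    ∃ (a b : Fin n → PointSet p) (_ : ∀ i, a i ≠ b i) (u v : EuclideanSpace ℝ (Fin n))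
      (hu : ‖u‖ = 1) (hv : ‖v‖ = 1), x = apartment a b u hu ∧ y = apartment a b v hv := by
  have : NeZero p := ⟨by omega⟩
  set a := center x y with ha
  have hb : ∀ i, ∃ b, a i ≠ b ∧ (y.pt i = none ∨ y.pt i = some (a i) ∨ y.pt i = some b) := by
    intro i
    rcases hy : y.pt i with _ | c
    · obtain ⟨b, hb⟩ := exists_ne_point hp (a i)
      exact ⟨b, hb, by simp⟩
    · by_cases h : a i = c
      · obtain ⟨b, hb⟩ := exists_ne_point hp (a i)
        exact ⟨b, hb, by simp [h]⟩
      · exact ⟨c, h, by simp⟩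
  choose b hab hyb using hb
  have key : ∀ z : SphericalJoin n (PointSet p),
      (∀ i, z.pt i = none ∨ z.pt i = some (a i) ∨ z.pt i = some (b i)) →
      z = apartment a b (fold a z) (norm_fold a z) := by
    intro z hz
    have hi : ∀ i, z.wt i = |fold a z i| ∧ z.pt i = (if fold a z i = 0 then none else
        if 0 < fold a z i then some (a i) else some (b i)) := by
      intro i
      rw [fold_apply]
      have h0 := z.wt_nonneg i
      rcases hz i with h | h | h
      · simp [wt_eq_zero h, h]
      · have hw : z.wt i ≠ 0 := fun h' => by rw [(z.pt_eq_none i).2 h'] at h; cases h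
        rw [h, side_some_self, mul_one, if_neg hw, if_pos (lt_of_le_of_ne h0 hw.symm)]
        exact ⟨(abs_of_nonneg h0).symm, rfl⟩
      · have hw : z.wt i ≠ 0 := fun h' => by rw [(z.pt_eq_none i).2 h'] at h; cases h
        rw [h, side_of_ne (by simpa using (hab i).symm), mul_neg_one, if_neg (neg_ne_zero.2 hw),
          if_neg (by linarith)]
        exact ⟨by rw [abs_neg, abs_of_nonneg h0], rfl⟩
    ext1
    · exact funext fun i => (hi i).1
    · exact funext fun i => (hi i).2
  exact ⟨a, b, hab, _, _, norm_fold a x, norm_fold a y,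
    key x fun i => (pt_eq_center x y i).imp_right Or.inl, key y hyb⟩

end SphericalJoin

namespace SphericalJoin

variable {n p : ℕ}

open InnerProductGeometry

/-! ### The join is a CAT(1) space -/

/-- The CAT(1) inequality for a vertex `q` and a point `m` of the opposite side `[x, y]`, in terms
of cosines. By the equality case of the triangle inequality, the points of `m` occur in `x` or `y`,
so the folding centred at `m` is isometric on `{x, m, y}` and on `{q, m}`; on the sphere `m` is a
nonnegative combination of `x` and `y`. -/
theorem sin_mul_joinCos_le [NeZero p] {x m y : SphericalJoin n (PointSet p)} {a s : ℝ}
    (hs : 0 ≤ s) (hsa : s ≤ a) (ha : a < Real.pi) (hxm : Real.arccos (joinCos x m) = s)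
    (hmy : Real.arccos (joinCos m y) = a - s) (hxy : Real.arccos (joinCos x y) = a)
    (q : SphericalJoin n (PointSet p)) :
    Real.sin (a - s) * joinCos q x + Real.sin s * joinCos q y ≤ Real.sin a * joinCos q m := by
  set c := center x y with hc
  have hsum : ∑ i, m.wt i * y.wt i * cosDist (m.pt i) (y.pt i) =
      ∑ i, m.wt i * y.wt i * (side (c i) (m.pt i) * side (c i) (y.pt i)) := by
    have e1 : angle (fold c x) (fold c y) = a := by
      rw [(visible_center x y y).angle_fold_eq, hxy]
    have e2 : angle (fold c x) (fold c m) = s := by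
      rw [(visible_center x y m).angle_fold_eq, hxm]
    have e3 := angle_le_angle_add_angle (fold c x) (fold c m) (fold c y)
    have e4 := angle_fold_le c m y
    have e5 : angle (fold c m) (fold c y) = Real.arccos (joinCos m y) := by linarith
    rw [angle_eq_arccos_inner (norm_fold c m) (norm_fold c y)] at e5
    have h1 := joinCos_mem m y
    have h2 : inner ℝ (fold c m) (fold c y) ∈ Set.Icc (-1 : ℝ) 1 :=
      ⟨neg_one_le_real_inner_of_norm_eq_one (norm_fold _ _) (norm_fold _ _),
        real_inner_le_one_of_norm_eq_one (norm_fold _ _) (norm_fold _ _)⟩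
    have e6 := Real.arccos_injOn h2 h1 e5
    rw [inner_fold] at e6
    exact e6.symm
  have hterm := (Finset.sum_eq_sum_iff_of_le fun i _ => term_le_fold c m y i).1 hsum
  -- The new center contains `m`, and agrees with `c` where `m` records no point.
  set c' : Fin n → PointSet p := fun i => (m.pt i).getD (c i) with hc'
  have hm : ∀ i, m.pt i = none ∨ m.pt i = some (c' i) := fun i => by
    rcases hi : m.pt i <;> simp [hc', hi]
  have vxy : Visible c' x y := by
    intro i
    rcases hmi : m.pt i with _ | z
    · have : c' i = c i := by simp [hc', hmi]
      rw [this]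
      exact visible_center x y y i
    have hcz : c' i = z := by simp [hc', hmi]
    rcases hx : x.pt i with _ | α
    · simp
    rcases hy : y.pt i with _ | β
    · simp
    by_cases hαz : α = z
    · simp [hcz, hαz]
    by_cases hαβ : α = β
    · simp [hαβ]
    have hci : c i = α := by simp [hc, center, hx]
    have ht := hterm i (Finset.mem_univ i)
    have hm0 : m.wt i ≠ 0 := fun h => by rw [(m.pt_eq_none i).2 h] at hmi; cases hmi
    have hy0 : y.wt i ≠ 0 := fun h => by rw [(y.pt_eq_none i).2 h] at hy; cases hy
    rw [hmi, hy, hci, side_of_ne (by simpa using Ne.symm hαz),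
      side_of_ne (by simpa using Ne.symm hαβ)] at ht
    have ht' := mul_left_cancel₀ (mul_ne_zero hm0 hy0) ht
    by_cases hzβ : z = β
    · simp [hcz, hzβ]
    · rw [cosDist_some_of_ne hzβ] at ht'
      norm_num at ht'
  have vm : ∀ z, Visible c' z m := fun z i => by
    rcases hm i with h | h <;> simp [h]
  have vm' : ∀ z, Visible c' m z := fun z i => by
    rcases hm i with h | h <;> simp [h]
  have key := sin_smul_of_angle_add_angle (norm_fold c' x) (norm_fold c' m) (norm_fold c' y)
    (by rw [(vm x).angle_fold_eq, hxm]) (by rw [(vm' y).angle_fold_eq, hmy])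
    (by rw [vxy.angle_fold_eq, hxy])
  rw [← (vm q).inner_fold_eq, ← real_inner_smul_right, key, inner_add_right,
    real_inner_smul_right, real_inner_smul_right]
  have h1 : 0 ≤ Real.sin (a - s) :=
    Real.sin_nonneg_of_nonneg_of_le_pi (by linarith) (by linarith)
  have h2 : 0 ≤ Real.sin s := Real.sin_nonneg_of_nonneg_of_le_pi hs (by linarith)
  exact add_le_add (mul_le_mul_of_nonneg_left (joinCos_le_inner_fold c' q x) h1)
    (mul_le_mul_of_nonneg_left (joinCos_le_inner_fold c' q y) h2)

theorem arccos_of_edist_eq (hn : n ≠ 1) {x y : SphericalJoin n (PointSet p)} {r : ℝ} (hr : 0 ≤ r)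
    (h : edist x y = ENNReal.ofReal r) : Real.arccos (joinCos x y) = r := by
  rw [edist_eq_arccos hn] at h
  exact (ENNReal.ofReal_eq_ofReal_iff (Real.arccos_nonneg _) hr).1 h

theorem exists_geodesic (hn : n ≠ 1) (hp : 2 ≤ p) (x y : SphericalJoin n (PointSet p))
    (h : Real.arccos (joinCos x y) < Real.pi) : ∃ (ℓ : ℝ) (c : ℝ → SphericalJoin n (PointSet p)),
    IsGeodesic x y ℓ c := by
  have : NeZero p := ⟨by omega⟩
  obtain ⟨a, b, hab, u, v, hu, hv, rfl, rfl⟩ := exists_apartment hp x y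
  rw [joinCos_apartment hab hu hv] at h
  set ℓ := Real.arccos (inner ℝ u v) with hℓ
  have hℓ0 : 0 ≤ ℓ := Real.arccos_nonneg _
  have huv : inner ℝ u v = Real.cos ℓ := by
    rw [← angle_eq_arccos_inner hu hv] at hℓ
    rw [hℓ, inner_eq_cos_angle_of_norm_eq_one hu hv]
  rcases hℓ0.eq_or_lt with h0 | hpos
  · rw [← h0, Real.cos_zero, inner_eq_one_iff_of_norm_eq_one hu hv] at huv
    subst huv
    refine ⟨0, fun _ => apartment a b u hu, le_rfl, rfl, rfl, fun s hs t ht => ?_⟩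
    have hs0 : s = 0 := le_antisymm hs.2 hs.1
    have ht0 : t = 0 := le_antisymm ht.2 ht.1
    rw [edist_eq_arccos hn, joinCos_self, hs0, ht0]
    simp
  have hsin : Real.sin ℓ ≠ 0 := (Real.sin_pos_of_pos_of_lt_pi hpos h).ne'
  -- The unit vector tangent at `u` to the great circle through `u` and `v`.
  set w := (Real.sin ℓ)⁻¹ • (v - Real.cos ℓ • u) with hw
  have huu : inner ℝ u u = (1 : ℝ) := inner_self_eq_one_of_norm_eq_one hu
  have hvv : inner ℝ v v = (1 : ℝ) := inner_self_eq_one_of_norm_eq_one hv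
  have hvu : inner ℝ v u = Real.cos ℓ := by rw [real_inner_comm, huv]
  have huw : inner ℝ u w = (0 : ℝ) := by
    rw [hw, real_inner_smul_right, inner_sub_right, real_inner_smul_right, huv, huu]
    ring
  have hww : inner ℝ w w = (1 : ℝ) := by
    rw [hw]
    simp only [real_inner_smul_right, real_inner_smul_left, inner_sub_right, inner_sub_left,
      huv, hvu, huu, hvv]
    have := Real.sin_sq_add_cos_sq ℓ
    field_simp
    linarith
  have hwu : inner ℝ w u = (0 : ℝ) := by rw [real_inner_comm, huw]
  have hin : ∀ s t : ℝ, inner ℝ (Real.cos s • u + Real.sin s • w)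
      (Real.cos t • u + Real.sin t • w) = Real.cos (s - t) := by
    intro s t
    simp only [real_inner_smul_right, real_inner_smul_left, inner_add_right, inner_add_left,
      huu, hww, huw, hwu, Real.cos_sub]
    ring
  have hnorm : ∀ t : ℝ, ‖Real.cos t • u + Real.sin t • w‖ = 1 := fun t => by
    have h1 := hin t t
    rw [sub_self, Real.cos_zero, real_inner_self_eq_norm_sq] at h1
    exact (sq_eq_sq₀ (norm_nonneg _) zero_le_one).1 (by rw [h1, one_pow])
  have hend : Real.cos ℓ • u + Real.sin ℓ • w = v := by
    rw [hw, smul_smul, mul_inv_cancel₀ hsin, one_smul, add_sub_cancel]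
  refine ⟨ℓ, fun t => apartment a b _ (hnorm t), hℓ0, ?_, ?_, fun s hs t ht => ?_⟩
  · simp only [Real.cos_zero, Real.sin_zero, one_smul, zero_smul, add_zero]
  · simp only [hend]
  · rw [edist_eq_arccos hn, joinCos_apartment hab, hin, ← Real.cos_abs, Real.arccos_cos]
    · exact abs_nonneg _
    · rw [abs_le]
      constructor <;> linarith [hs.1, hs.2, ht.1, ht.2]

/-- The comparison inequality of two sides, obtained by applying the inequality for a vertex and a
point of the opposite side twice. -/
theorem comparison (hn : n ≠ 1) [NeZero p] (x y z : SphericalJoin n (PointSet p)) (a b e : ℝ)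
    (cxy cxz cyz : ℝ → SphericalJoin n (PointSet p)) (hxy : IsGeodesic x y a cxy)
    (hxz : IsGeodesic x z b cxz) (hyz : IsGeodesic y z e cyz) (hper : a + b + e < 2 * Real.pi)
    (x' y' z' : EuclideanSpace ℝ (Fin 3)) (hxy' : SphereDist x' y' a) (hxz' : SphereDist x' z' b)
    (hyz' : SphereDist y' z' e) (s : ℝ) (hs : s ∈ Set.Icc 0 a) (t : ℝ) (ht : t ∈ Set.Icc 0 b)
    (u' v' : EuclideanSpace ℝ (Fin 3)) (hxu' : SphereDist x' u' s)
    (huy' : SphereDist u' y' (a - s)) (hxv' : SphereDist x' v' t)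
    (hvz' : SphereDist v' z' (b - t)) :
    edist (cxy s) (cxz t) ≤ ENNReal.ofReal (angle u' v') := by
  obtain ⟨ha0, hx1, hy1, hg1⟩ := hxy
  obtain ⟨hb0, hx2, hz2, hg2⟩ := hxz
  obtain ⟨he0, hy3, hz3, hg3⟩ := hyz
  have memL : ∀ {r : ℝ}, 0 ≤ r → (0 : ℝ) ∈ Set.Icc 0 r := fun h => ⟨le_rfl, h⟩
  have memR : ∀ {r : ℝ}, 0 ≤ r → r ∈ Set.Icc 0 r := fun h => ⟨h, le_rfl⟩
  have dxy : Real.arccos (joinCos x y) = a := by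
    have := hg1 0 (memL ha0) a (memR ha0)
    rw [hx1, hy1, zero_sub, abs_neg, abs_of_nonneg ha0] at this
    exact arccos_of_edist_eq hn ha0 this
  have dxz : Real.arccos (joinCos x z) = b := by
    have := hg2 0 (memL hb0) b (memR hb0)
    rw [hx2, hz2, zero_sub, abs_neg, abs_of_nonneg hb0] at this
    exact arccos_of_edist_eq hn hb0 this
  have dyz : Real.arccos (joinCos y z) = e := by
    have := hg3 0 (memL he0) e (memR he0)
    rw [hy3, hz3, zero_sub, abs_neg, abs_of_nonneg he0] at this
    exact arccos_of_edist_eq hn he0 this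
  set u := cxy s with hu
  set v := cxz t with hv
  have dxu : Real.arccos (joinCos x u) = s := by
    have := hg1 0 (memL ha0) s hs
    rw [hx1, zero_sub, abs_neg, abs_of_nonneg hs.1] at this
    exact arccos_of_edist_eq hn hs.1 this
  have duy : Real.arccos (joinCos u y) = a - s := by
    have := hg1 s hs a (memR ha0)
    rw [hy1, abs_sub_comm, abs_of_nonneg (sub_nonneg.2 hs.2)] at this
    exact arccos_of_edist_eq hn (sub_nonneg.2 hs.2) this
  have dxv : Real.arccos (joinCos x v) = t := by
    have := hg2 0 (memL hb0) t ht
    rw [hx2, zero_sub, abs_neg, abs_of_nonneg ht.1] at this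
    exact arccos_of_edist_eq hn ht.1 this
  have dvz : Real.arccos (joinCos v z) = b - t := by
    have := hg2 t ht b (memR hb0)
    rw [hz2, abs_sub_comm, abs_of_nonneg (sub_nonneg.2 ht.2)] at this
    exact arccos_of_edist_eq hn (sub_nonneg.2 ht.2) this
  rw [edist_eq_arccos hn]
  refine ENNReal.ofReal_le_ofReal ?_
  have hx1' := hxy'.1
  have hy1' := hxy'.2.1
  have hz1' := hxz'.2.1
  have hu1' := hxu'.2.1
  have hv1' := hxv'.2.1
  -- The degenerate cases, in which one of the two sides through `x` is a point.
  rcases ha0.eq_or_lt with ha | ha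
  · have hs0 : s = 0 := le_antisymm (hs.2.trans ha.ge) hs.1
    have hux' : x' = u' := by
      have := hxu'.2.2
      rw [hs0] at this
      exact eq_of_angle_eq_zero_of_norm_eq this (by rw [hx1', hu1'])
    have hux : u = x := by rw [hu, hs0, hx1]
    rw [hux, dxv, ← hux', hxv'.2.2]
  rcases hb0.eq_or_lt with hb | hb
  · have ht0 : t = 0 := le_antisymm (ht.2.trans hb.ge) ht.1
    have hvx' : x' = v' := by
      have := hxv'.2.2
      rw [ht0] at this
      exact eq_of_angle_eq_zero_of_norm_eq this (by rw [hx1', hv1'])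
    have hvx : v = x := by rw [hv, ht0, hx2]
    rw [hvx, joinCos_comm, dxu, ← hvx', angle_comm, hxu'.2.2]
  have t1 := arccos_joinCos_triangle x z y
  have t2 := arccos_joinCos_triangle x y z
  rw [joinCos_comm z y] at t1
  have haπ : a < Real.pi := by linarith
  have hbπ : b < Real.pi := by linarith
  have sa : 0 < Real.sin a := Real.sin_pos_of_pos_of_lt_pi ha haπ
  have sb : 0 < Real.sin b := Real.sin_pos_of_pos_of_lt_pi hb hbπ
  have ss : 0 ≤ Real.sin s := Real.sin_nonneg_of_nonneg_of_le_pi hs.1 (by linarith [hs.2])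
  have cosOf : ∀ {w w' : SphericalJoin n (PointSet p)} {r : ℝ},
      Real.arccos (joinCos w w') = r → joinCos w w' = Real.cos r := fun {w w' r} h => by
    rw [← h, Real.cos_arccos (joinCos_mem w w').1 (joinCos_mem w w').2]
  have innerOf : ∀ {w w' : EuclideanSpace ℝ (Fin 3)} {r : ℝ},
      SphereDist w w' r → inner ℝ w w' = Real.cos r := fun {w w' r} h => by
    rw [inner_eq_cos_angle_of_norm_eq_one h.1 h.2.1, h.2.2]
  have k1 := sin_mul_joinCos_le hs.1 hs.2 haπ dxu duy dxy v
  have k2 := sin_mul_joinCos_le ht.1 ht.2 hbπ dxv dvz dxz y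
  have l1 := sin_smul_of_angle_add_angle hx1' hu1' hy1' hxu'.2.2 huy'.2.2 hxy'.2.2
  have l2 := sin_smul_of_angle_add_angle hx1' hv1' hz1' hxv'.2.2 hvz'.2.2 hxz'.2.2
  have m2 : inner ℝ y' v' ≤ joinCos y v := by
    refine le_of_mul_le_mul_left ?_ sb
    refine le_trans (le_of_eq ?_) k2
    rw [← real_inner_smul_right, l2, inner_add_right, real_inner_smul_right,
      real_inner_smul_right, real_inner_comm, innerOf hxy', innerOf hyz', joinCos_comm y x,
      cosOf dxy, cosOf dyz]
  have m1 : inner ℝ v' u' ≤ joinCos v u := by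
    refine le_of_mul_le_mul_left ?_ sa
    refine le_trans ?_ k1
    rw [← real_inner_smul_right, l1, inner_add_right, real_inner_smul_right,
      real_inner_smul_right, real_inner_comm, innerOf hxv', joinCos_comm v x, cosOf dxv,
      real_inner_comm, joinCos_comm v y]
    exact add_le_add le_rfl (mul_le_mul_of_nonneg_left m2 ss)
  rw [angle_comm, angle_eq_arccos_inner hv1' hu1', joinCos_comm]
  exact Real.arccos_le_arccos m1

theorem isCAT1_of_ne_one (hn : n ≠ 1) (hp : 2 ≤ p) : IsCAT1 (SphericalJoin n (PointSet p)) := by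
  have : NeZero p := ⟨by omega⟩
  refine ⟨fun x y => ?_, fun x y => ?_, fun x y z => ?_, fun x y h => ?_, comparison hn⟩
  · rw [edist_eq_arccos hn, ENNReal.ofReal_eq_zero, (Real.arccos_nonneg _).ge_iff_eq',
      Real.arccos_eq_zero, ← joinCos_eq_one_iff]
    exact ⟨fun h => le_antisymm (joinCos_mem x y).2 h, fun h => h.ge⟩
  · rw [edist_eq_arccos hn, edist_eq_arccos hn, joinCos_comm]
  · rw [edist_eq_arccos hn, edist_eq_arccos hn, edist_eq_arccos hn,
      ← ENNReal.ofReal_add (Real.arccos_nonneg _) (Real.arccos_nonneg _)]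
    exact ENNReal.ofReal_le_ofReal (arccos_joinCos_triangle x y z)
  · rw [edist_eq_arccos hn] at h
    exact exists_geodesic hn hp x y ((ENNReal.ofReal_lt_ofReal_iff Real.pi_pos).1 h)

end SphericalJoin

/-- A space in which distinct points are at infinite distance is CAT(1): all geodesics are
constant. -/
theorem isCAT1_of_discrete {X : Type} [EDist X] (h0 : ∀ x : X, edist x x = 0)
    (h : ∀ x y : X, x ≠ y → edist x y = ⊤) : IsCAT1 X := by
  have fin : ∀ x y : X, edist x y ≠ ⊤ → x = y := fun x y hxy => by
    by_contra hne
    exact hxy (h x y hne)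
  have zero : ∀ {x y : X} {a : ℝ} {c : ℝ → X}, IsGeodesic x y a c → a = 0 := by
    rintro x y a c ⟨ha, rfl, rfl, hg⟩
    have e := hg 0 ⟨le_rfl, ha⟩ a ⟨ha, le_rfl⟩
    have : c 0 = c a := fin _ _ (by rw [e]; exact ENNReal.ofReal_ne_top)
    rw [this, h0, eq_comm, ENNReal.ofReal_eq_zero, zero_sub, abs_neg, abs_of_nonneg ha] at e
    exact le_antisymm e ha
  refine ⟨fun x y => ⟨fun hxy => fin x y (by simp [hxy]), fun hxy => hxy ▸ h0 x⟩, fun x y => ?_,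
    fun x y z => ?_, fun x y hxy => ?_, ?_⟩
  · by_cases hxy : x = y
    · rw [hxy]
    · rw [h x y hxy, h y x (Ne.symm hxy)]
  · by_cases hxy : x = y
    · rw [hxy, h0, zero_add]
    · rw [h x y hxy, top_add]
      exact le_top
  · obtain rfl := fin x y (ne_top_of_lt hxy)
    refine ⟨0, fun _ => x, le_rfl, rfl, rfl, fun s hs t ht => ?_⟩
    have hs0 : s = 0 := le_antisymm hs.2 hs.1
    have ht0 : t = 0 := le_antisymm ht.2 ht.1
    rw [h0, hs0, ht0]
    simp
  · intro x y z a b e cxy cxz cyz hxy hxz _ _ x' y' z' _ _ _ s hs t ht u' v' _ _ _ _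
    have hs0 : s = 0 := le_antisymm (hs.2.trans (zero hxy).le) hs.1
    have ht0 : t = 0 := le_antisymm (ht.2.trans (zero hxz).le) ht.1
    rw [hs0, ht0, hxy.2.1, hxz.2.1, h0]
    exact zero_le

/-- The CAT(1) property is invariant under isometric bijections. -/
theorem IsCAT1.of_equiv {X Y : Type} [EDist X] [EDist Y] (Φ : X ≃ Y)
    (hΦ : ∀ x y, edist (Φ x) (Φ y) = edist x y) (hY : IsCAT1 Y) : IsCAT1 X := by
  have geo : ∀ {x y : X} {a : ℝ} {c : ℝ → X}, IsGeodesic x y a c →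
      IsGeodesic (Φ x) (Φ y) a (fun t => Φ (c t)) := by
    rintro x y a c ⟨ha, rfl, rfl, hg⟩
    exact ⟨ha, rfl, rfl, fun s hs t ht => (hΦ _ _).trans (hg s hs t ht)⟩
  refine ⟨fun x y => ?_, fun x y => ?_, fun x y z => ?_, fun x y hxy => ?_, ?_⟩
  · rw [← hΦ, hY.edist_eq_zero_iff, Φ.apply_eq_iff_eq]
  · rw [← hΦ, hY.edist_comm, hΦ]
  · rw [← hΦ, ← hΦ x y, ← hΦ y z]
    exact hY.edist_triangle _ _ _
  · obtain ⟨ℓ, c, h0, h1, h2, h3⟩ := hY.exists_geodesic (Φ x) (Φ y) (by rwa [hΦ])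
    refine ⟨ℓ, fun t => Φ.symm (c t), h0, Φ.symm_apply_eq.2 h1, Φ.symm_apply_eq.2 h2,
      fun s hs t ht => ?_⟩
    rw [← hΦ, Φ.apply_symm_apply, Φ.apply_symm_apply]
    exact h3 s hs t ht
  · intro x y z a b e cxy cxz cyz hxy hxz hyz hper x' y' z' h1 h2 h3 s hs t ht u' v' h4 h5 h6 h7
    rw [← hΦ]
    exact hY.comparison _ _ _ a b e _ _ _ (geo hxy) (geo hxz) (geo hyz) hper x' y' z' h1 h2 h3
      s hs t ht u' v' h4 h5 h6 h7

/-! ### Cosets in groups with the braid relations of type `B` -/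

section BraidB

variable {G : Type} [Group G]

/-- The elements `s 0, …, s (n - 1)` satisfy the braid relations of the diagram `B_n`, and
`s 1, …, s (n - 1)` are involutions. (The relations that do not mention `n` hold for all indices
if the family is continued by `1`.) -/
structure BraidB (n : ℕ) (s : ℕ → G) : Prop where
  mul_self : ∀ j, 1 ≤ j → s j * s j = 1
  braid_four : s 0 * s 1 * s 0 * s 1 = s 1 * s 0 * s 1 * s 0
  braid_three : ∀ j, 1 ≤ j → j + 1 < n → s j * s (j + 1) * s j = s (j + 1) * s j * s (j + 1)
  comm : ∀ i j, i + 1 < j → Commute (s i) (s j)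

/-- The product `s 1 ⋯ s m`. -/
def upProd (s : ℕ → G) : ℕ → G
  | 0 => 1
  | m + 1 => upProd s m * s (m + 1)

/-- The subgroup generated by `s 0, …, s (k - 1)`. -/
def initialSubgroup (s : ℕ → G) (k : ℕ) : Subgroup G := Subgroup.closure (s '' {j | j < k})

variable {n : ℕ} {s : ℕ → G}

namespace BraidB

theorem inv_eq (h : BraidB n s) {j : ℕ} (hj : 1 ≤ j) : (s j)⁻¹ = s j :=
  inv_eq_of_mul_eq_one_left (h.mul_self j hj)

theorem commute_upProd (h : BraidB n s) {j m : ℕ} (hj : m + 1 < j) :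
    Commute (s j) (upProd s m) := by
  induction m with
  | zero => exact Commute.one_right _
  | succ m ih => exact (ih (by omega)).mul_right (h.comm _ _ (by omega)).symm

theorem mul_upProd (h : BraidB n s) {j m : ℕ} (hj : 1 ≤ j) (hjm : j + 1 ≤ m) (hm : m < n) :
    s (j + 1) * upProd s m = upProd s m * s j := by
  induction m, hjm using Nat.le_induction with
  | base =>
    obtain ⟨k, rfl⟩ : ∃ k, j = k + 1 := ⟨j - 1, by omega⟩
    have hc : Commute (s (k + 1 + 1)) (upProd s k) := h.commute_upProd (by omega)
    have hb := h.braid_three (k + 1) hj (by omega)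
    simp only [upProd]
    calc s (k + 1 + 1) * (upProd s k * s (k + 1) * s (k + 1 + 1))
        = upProd s k * (s (k + 1 + 1) * s (k + 1) * s (k + 1 + 1)) := by
          simp only [← mul_assoc, hc.eq]
      _ = upProd s k * s (k + 1) * s (k + 1 + 1) * s (k + 1) := by
          rw [← hb]
          simp only [mul_assoc]
  | succ m hjm ih =>
    have hc : Commute (s j) (s (m + 1)) := h.comm _ _ (by omega)
    rw [upProd, ← mul_assoc, ih (by omega), mul_assoc, hc.eq, mul_assoc]

theorem upProd_mul_zero (h : BraidB n s) {m : ℕ} (hm : 1 ≤ m) :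
    upProd s m * s 0 = s 1 * s 0 * s 1 * upProd s m := by
  induction m, hm using Nat.le_induction with
  | base =>
    simp only [upProd, zero_add, one_mul]
    rw [mul_assoc _ (s 1) (s 1), h.mul_self 1 le_rfl, mul_one]
  | succ m hm ih =>
    have hc : Commute (s 0) (s (m + 1)) := h.comm _ _ (by omega)
    rw [upProd, mul_assoc, ← hc.eq, ← mul_assoc, ih, mul_assoc]

theorem mem_initialSubgroup {j k : ℕ} (hj : j < k) : s j ∈ initialSubgroup s k :=
  Subgroup.subset_closure ⟨j, hj, rfl⟩

/-- The cosets of `⟨s 0, …, s (m - 1)⟩` in `⟨s 0, …, s m⟩` are represented by the elements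
`(s 1 ⋯ s i)⁻¹ (s 0)ᵃ (s 1 ⋯ s m)` with `i ≤ m`: by the braid relations, the union of these cosets
is stable under left multiplication by the generators. -/
theorem exists_coset (h : BraidB n s) {m : ℕ} (hm : m < n) {g : G}
    (hg : g ∈ initialSubgroup s (m + 1)) :
    ∃ i ≤ m, ∃ a : ℤ, ∃ g' ∈ initialSubgroup s m,
      g = (upProd s i)⁻¹ * s 0 ^ a * upProd s m * g' := by
  -- The representative is transformed by `x` on the left into itself times `y` on the right.
  have slide : ∀ {x x' y : G} {i : ℕ} {a : ℤ} {g' : G}, x * (upProd s i)⁻¹ = (upProd s i)⁻¹ * x' →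
      Commute x' (s 0) → x' * upProd s m = upProd s m * y →
      x * ((upProd s i)⁻¹ * s 0 ^ a * upProd s m * g') =
        (upProd s i)⁻¹ * s 0 ^ a * upProd s m * (y * g') := by
    intro x x' y i a g' h1 h2 h3
    have h4 := (h2.zpow_right a).eq
    calc x * ((upProd s i)⁻¹ * s 0 ^ a * upProd s m * g')
        = (x * (upProd s i)⁻¹) * s 0 ^ a * upProd s m * g' := by simp only [mul_assoc]
      _ = (upProd s i)⁻¹ * (x' * s 0 ^ a) * upProd s m * g' := by rw [h1]; simp only [mul_assoc]
      _ = (upProd s i)⁻¹ * s 0 ^ a * (x' * upProd s m) * g' := by rw [h4]; simp only [mul_assoc]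
      _ = _ := by rw [h3]; simp only [mul_assoc]
  have flip : ∀ {x y u : G}, u * x = y * u → y⁻¹ * u = u * x⁻¹ := by
    intro x y u hxy
    rw [inv_mul_eq_iff_eq_mul, ← mul_assoc, ← hxy, mul_inv_cancel_right]
  have swap : ∀ {x y u : G}, u * x = y * u → x * u⁻¹ = u⁻¹ * y := by
    intro x y u hxy
    rw [eq_inv_mul_iff_mul_eq, ← mul_assoc, hxy, mul_inv_cancel_right]
  -- The generators `s j` with `j ≥ 1`, which are their own inverses.
  have pos : ∀ {j : ℕ} {i : ℕ} {a : ℤ} {g' : G}, 1 ≤ j → j ≤ m → i ≤ m →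
      g' ∈ initialSubgroup s m → ∃ i' ≤ m, ∃ a' : ℤ, ∃ g'' ∈ initialSubgroup s m,
      s j * ((upProd s i)⁻¹ * s 0 ^ a * upProd s m * g') =
        (upProd s i')⁻¹ * s 0 ^ a' * upProd s m * g'' := by
    intro j i a g' hj hjm him hg'
    rcases lt_trichotomy j i with hlt | rfl | hlt
    · have e : upProd s i * s j = s (j + 1) * upProd s i := (h.mul_upProd hj hlt (by omega)).symm
      exact ⟨i, him, a, _, mul_mem (mem_initialSubgroup (by omega)) hg',
        slide (swap e) (h.comm 0 (j + 1) (by omega)).symm (h.mul_upProd hj (by omega) hm)⟩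
    · obtain ⟨k, rfl⟩ : ∃ k, j = k + 1 := ⟨j - 1, by omega⟩
      refine ⟨k, by omega, a, g', hg', ?_⟩
      rw [upProd, mul_inv_rev]
      simp only [← mul_assoc]
      rw [mul_inv_cancel, one_mul]
    · rcases Nat.eq_or_lt_of_le (Nat.succ_le_of_lt hlt) with rfl | hlt'
      · refine ⟨i + 1, hjm, a, g', hg', ?_⟩
        rw [upProd, mul_inv_rev, h.inv_eq hj]
        simp only [← mul_assoc]
      · obtain ⟨k, rfl⟩ : ∃ k, j = k + 1 := ⟨j - 1, by omega⟩
        have hc : Commute (s (k + 1)) (upProd s i) := h.commute_upProd hlt'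
        exact ⟨i, him, a, _, mul_mem (mem_initialSubgroup (by omega)) hg',
          slide hc.inv_right.eq (h.comm 0 (k + 1) (by omega)).symm
            (h.mul_upProd (by omega) hjm hm)⟩
  -- The conjugate of `s 0` by which `s 0` is moved past `s 1 ⋯ s i` for `i ≥ 1`.
  set r := s 1 * s 0 * s 1 with hr
  have hr0 : Commute r (s 0) := by
    rw [Commute, SemiconjBy, hr, ← h.braid_four]
    simp only [mul_assoc]
  refine Subgroup.closure_induction_left (s := s '' {j | j < m + 1})
    (p := fun g _ => ∃ i ≤ m, ∃ a : ℤ, ∃ g' ∈ initialSubgroup s m,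
      g = (upProd s i)⁻¹ * s 0 ^ a * upProd s m * g')
    ⟨m, le_rfl, 0, 1, one_mem _, by simp⟩ ?_ ?_ hg
  · rintro _ ⟨j, hj, rfl⟩ _ _ ⟨i, hi, a, g', hg', rfl⟩
    have hjm : j ≤ m := Nat.le_of_lt_succ hj
    rcases Nat.eq_zero_or_pos j with rfl | hj1
    · rcases Nat.eq_zero_or_pos i with rfl | hi1
      · refine ⟨0, hi, a + 1, g', hg', ?_⟩
        rw [zpow_add_one, ← (Commute.self_zpow (s 0) a).eq]
        simp [upProd, mul_assoc]
      · exact ⟨i, hi, a, _, mul_mem (mem_initialSubgroup (by omega)) hg',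
          slide (swap (h.upProd_mul_zero hi1)) hr0 (h.upProd_mul_zero (by omega)).symm⟩
    · exact pos hj1 hjm hi hg'
  · rintro _ ⟨j, hj, rfl⟩ _ _ ⟨i, hi, a, g', hg', rfl⟩
    have hjm : j ≤ m := Nat.le_of_lt_succ hj
    rcases Nat.eq_zero_or_pos j with rfl | hj1
    · rcases Nat.eq_zero_or_pos i with rfl | hi1
      · refine ⟨0, hi, a - 1, g', hg', ?_⟩
        rw [zpow_sub_one, ← ((Commute.self_zpow (s 0) a).inv_left).eq]
        simp [upProd, mul_assoc]
      · refine ⟨i, hi, a, _, mul_mem (inv_mem (mem_initialSubgroup (j := 0) (by omega))) hg',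
          slide (x' := r⁻¹) ?_ hr0.inv_left (flip (h.upProd_mul_zero (by omega)))⟩
        have e := flip (h.upProd_mul_zero hi1)
        exact swap e.symm
    · rw [h.inv_eq hj1]
      exact pos hj1 hjm hi hg'

end BraidB

end BraidB

/-! ### The Shephard group of `B_n(p, 2)` as a group of monomial transformations -/

theorem altProd_two {G : Type} [Group G] (a b : G) : altProd a b 2 = a * b := by
  simp [altProd]

theorem altProd_three {G : Type} [Group G] (a b : G) : altProd a b 3 = a * b * a := by
  have h : ¬ Even 3 := by decide
  simp [altProd, h]

theorem altProd_four {G : Type} [Group G] (a b : G) : altProd a b 4 = a * b * a * b := by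
  have h : Even 4 := by decide
  simp [altProd, h, pow_two, mul_assoc]

theorem map_altProd {G H : Type} [Group G] [Group H] (f : G →* H) (a b : G) (m : ℕ) :
    f (altProd a b m) = altProd (f a) (f b) m := by
  unfold altProd
  split_ifs <;> simp

namespace MonomialAction

variable {n p : ℕ}

/-- The data of a point of the join in one coordinate: a weight and a recorded point. -/
abbrev Coord (p : ℕ) : Type := ℝ × Option (PointSet p)

/-- The action of a permutation of the points on the data in one coordinate. -/
def coordHom (p : ℕ) : Equiv.Perm (PointSet p) →* Equiv.Perm (Coord p) where
  toFun σ := Equiv.prodCongr (Equiv.refl ℝ) (Equiv.optionCongr σ)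
  map_one' := by ext ⟨w, o⟩ : 1; simp
  map_mul' σ τ := by ext ⟨w, o⟩ : 1; rcases o <;> simp

theorem coordHom_apply (σ : Equiv.Perm (PointSet p)) (y : Coord p) :
    coordHom p σ y = (y.1, y.2.map σ) := rfl

/-- The permutation `σ` of the points, acting in the coordinate `i` only. -/
def rotAt (i : Fin n) : Equiv.Perm (PointSet p) →* Equiv.Perm (Fin n → Coord p) where
  toFun σ := Equiv.piCongrRight fun j => coordHom p (if j = i then σ else 1)
  map_one' := by ext f : 1; funext j; simp
  map_mul' σ τ := by
    ext f : 1
    funext j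
    by_cases h : j = i <;> simp [h]

theorem rotAt_apply (i : Fin n) (σ : Equiv.Perm (PointSet p)) (f : Fin n → Coord p) (j : Fin n) :
    rotAt i σ f j = coordHom p (if j = i then σ else 1) (f j) := rfl

/-- The permutations of the coordinates. -/
def permute : Equiv.Perm (Fin n) →* Equiv.Perm (Fin n → Coord p) where
  toFun τ := Equiv.arrowCongr τ (Equiv.refl _)
  map_one' := rfl
  map_mul' _ _ := rfl

theorem permute_apply (τ : Equiv.Perm (Fin n)) (f : Fin n → Coord p) (j : Fin n) :
    permute τ f j = f (τ⁻¹ j) := rfl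

theorem permute_swap_apply (i k : Fin n) (f : Fin n → Coord p) (j : Fin n) :
    permute (Equiv.swap i k) f j = f (Equiv.swap i k j) := by
  rw [permute_apply, Equiv.swap_inv]

/-- The generator of the cyclic group of rotations of the `p` points. -/
def rot (p : ℕ) : Equiv.Perm (PointSet p) := finRotate p

theorem rot_isCycle (hp : 2 ≤ p) : (rot p).IsCycle := isCycle_finRotate_of_le hp

theorem rot_ne (hp : 2 ≤ p) (x : PointSet p) : rot p x ≠ x := by
  have h : ∀ y : Fin p, finRotate p y ≠ y := fun y => by
    rw [← Equiv.Perm.mem_support, support_finRotate_of_le hp]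
    exact Finset.mem_univ _
  exact h x

theorem orderOf_rot (hp : 2 ≤ p) : orderOf (rot p) = p := by
  have h : orderOf (finRotate p) = p := by
    rw [(isCycle_finRotate_of_le hp).orderOf, support_finRotate_of_le hp, Finset.card_univ,
      Fintype.card_fin]
  exact h

theorem exists_rot_zpow (hp : 2 ≤ p) (x y : PointSet p) : ∃ k : ℤ, (rot p ^ k) x = y :=
  (rot_isCycle hp).sameCycle (rot_ne hp x) (rot_ne hp y)

theorem dvd_of_rot_zpow_apply (hp : 2 ≤ p) {k : ℤ} {x : PointSet p} (h : (rot p ^ k) x = x) :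
    (p : ℤ) ∣ k := by
  rw [← orderOf_rot hp, orderOf_dvd_iff_zpow_eq_one]
  ext y : 1
  obtain ⟨l, rfl⟩ := exists_rot_zpow hp x y
  rw [← Equiv.Perm.mul_apply, (Commute.zpow_zpow_self (rot p) k l).eq, Equiv.Perm.mul_apply, h,
    Equiv.Perm.one_apply]

/-- The preceding coordinate. -/
def pred (i : Fin n) : Fin n := ⟨i - 1, by omega⟩

/-- The transformation by which the `i`-th generator acts: the rotation of the points of the first
coordinate for `i = 0`, and otherwise the exchange of the coordinates `i - 1` and `i`. -/
def genAct (i : Fin n) : Equiv.Perm (Fin n → Coord p) :=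
  if (i : ℕ) = 0 then rotAt i (rot p) else permute (Equiv.swap (pred i) i)

theorem genAct_zero {i : Fin n} (h : (i : ℕ) = 0) : genAct (p := p) i = rotAt i (rot p) :=
  if_pos h

theorem genAct_pos {i : Fin n} (h : (i : ℕ) ≠ 0) :
    genAct (p := p) i = permute (Equiv.swap (pred i) i) :=
  if_neg h

end MonomialAction

section Diagram

variable {n p : ℕ} {hp : 2 ≤ p}

theorem diagramB_four {i j : Fin n} (h : (i : ℕ) + 1 = j) (h0 : (i : ℕ) = 0) :
    (diagramB n p hp).m i j = 4 := by
  have hij : i ≠ j := fun e => by rw [e] at h; omega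
  change (if i = j then 1 else if (i : ℕ) + 1 = j ∨ (j : ℕ) + 1 = i then
    (if (i : ℕ) = 0 ∨ (j : ℕ) = 0 then 4 else 3) else 2) = 4
  rw [if_neg hij, if_pos (Or.inl h), if_pos (Or.inl h0)]

theorem diagramB_three {i j : Fin n} (h : (i : ℕ) + 1 = j) (h0 : (i : ℕ) ≠ 0) :
    (diagramB n p hp).m i j = 3 := by
  have hij : i ≠ j := fun e => by rw [e] at h; omega
  have hj : (j : ℕ) ≠ 0 := by omega
  change (if i = j then 1 else if (i : ℕ) + 1 = j ∨ (j : ℕ) + 1 = i then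
    (if (i : ℕ) = 0 ∨ (j : ℕ) = 0 then 4 else 3) else 2) = 3
  rw [if_neg hij, if_pos (Or.inl h), if_neg (by omega)]

theorem diagramB_two {i j : Fin n} (h : (i : ℕ) + 1 < j) :
    (diagramB n p hp).m i j = 2 := by
  have hij : i ≠ j := fun e => by rw [e] at h; omega
  change (if i = j then 1 else if (i : ℕ) + 1 = j ∨ (j : ℕ) + 1 = i then
    (if (i : ℕ) = 0 ∨ (j : ℕ) = 0 then 4 else 3) else 2) = 2
  rw [if_neg hij, if_neg (by omega)]

end Diagram

namespace MonomialAction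

variable {n p : ℕ}

theorem genAct_braid_of_lt (hp : 2 ≤ p) {i j : Fin n} (hij : i < j) :
    altProd (genAct (p := p) i) (genAct j) ((diagramB n p hp).m i j) =
      altProd (genAct j) (genAct i) ((diagramB n p hp).m i j) := by
  have hj : (j : ℕ) ≠ 0 := by have : (i : ℕ) < j := hij; omega
  rcases Nat.eq_or_lt_of_le (Nat.succ_le_of_lt (show (i : ℕ) < j from hij)) with h | h
  · have hpj : pred j = i := Fin.ext (by simp [pred, ← h])
    by_cases h0 : (i : ℕ) = 0
    · rw [diagramB_four h h0, altProd_four, altProd_four, genAct_zero h0, genAct_pos hj, hpj]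
      ext f : 1
      funext k
      simp only [Equiv.Perm.mul_apply, rotAt_apply, permute_swap_apply]
      by_cases hki : k = i
      · subst hki; simp [hij.ne']
      · by_cases hkj : k = j
        · subst hkj; simp [hki]
        · simp [hki, hkj, Equiv.swap_apply_of_ne_of_ne]
    · rw [diagramB_three h h0, altProd_three, altProd_three, genAct_pos h0, genAct_pos hj, hpj]
      have h1 : pred i ≠ i := fun e => by
        have := congrArg Fin.val e
        simp only [pred] at this
        omega
      have h2 : pred i ≠ j := fun e => by
        have := congrArg Fin.val e
        simp only [pred] at this
        omega
      rw [← map_mul, ← map_mul, ← map_mul, ← map_mul]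
      congr 1
      rw [Equiv.swap_mul_swap_mul_swap h1 h2, Equiv.swap_comm (pred i) i, Equiv.swap_comm i j,
        Equiv.swap_mul_swap_mul_swap hij.ne' h2.symm, Equiv.swap_comm]
  · have h2 : (pred j : ℕ) = j - 1 := rfl
    have hi1 : i ≠ pred j := fun e => by rw [e, h2] at h; omega
    have hi2 : i ≠ j := hij.ne
    rw [diagramB_two h, altProd_two, altProd_two, genAct_pos hj]
    by_cases h0 : (i : ℕ) = 0
    · rw [genAct_zero h0]
      ext f : 1
      funext k
      simp only [Equiv.Perm.mul_apply, rotAt_apply, permute_swap_apply]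
      have e : Equiv.swap (pred j) j k = i ↔ k = i := by
        rw [Equiv.swap_apply_eq_iff, Equiv.swap_apply_of_ne_of_ne hi1 hi2]
      simp only [e]
    · rw [genAct_pos h0, ← map_mul, ← map_mul]
      congr 1
      refine (Equiv.Perm.Disjoint.commute fun k => ?_).eq
      have h3 : (pred i : ℕ) = i - 1 := rfl
      by_cases hk : k = pred i ∨ k = i
      · right
        refine Equiv.swap_apply_of_ne_of_ne (fun e => ?_) (fun e => ?_) <;>
          rcases hk with rfl | rfl <;> have := congrArg Fin.val e <;> omega
      · left
        exact Equiv.swap_apply_of_ne_of_ne (fun e => hk (Or.inl e)) (fun e => hk (Or.inr e))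

theorem genAct_relators (hp : 2 ≤ p) :
    ∀ r ∈ (diagramB n p hp).relators, FreeGroup.lift (genAct (n := n) (p := p)) r = 1 := by
  rintro r (⟨i, rfl⟩ | ⟨i, j, rfl⟩)
  · rw [map_pow, FreeGroup.lift_apply_of]
    by_cases h : (i : ℕ) = 0
    · have : (diagramB n p hp).p i = p := if_pos h
      have hr : rot p ^ p = 1 := by
        rw [← orderOf_dvd_iff_pow_eq_one, orderOf_rot hp]
      rw [this, genAct_zero h, ← map_pow, hr, map_one]
    · have : (diagramB n p hp).p i = 2 := if_neg h
      rw [this, genAct_pos h, ← map_pow, pow_two, Equiv.swap_mul_self, map_one]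
  · rw [map_mul, map_inv, map_altProd, map_altProd, FreeGroup.lift_apply_of,
      FreeGroup.lift_apply_of, mul_inv_eq_one]
    rcases lt_trichotomy i j with h | rfl | h
    · exact genAct_braid_of_lt hp h
    · rfl
    · rw [(diagramB n p hp).m.symmetric]
      exact (genAct_braid_of_lt hp h).symm

/-- The action of the Shephard group on coordinate vectors. -/
def act (n p : ℕ) (hp : 2 ≤ p) :
    (diagramB n p hp).ShephardGroup →* Equiv.Perm (Fin n → Coord p) :=
  PresentedGroup.toGroup (genAct_relators hp)

variable {hp : 2 ≤ p}

theorem act_of (i : Fin n) : act n p hp (PresentedGroup.of i) = genAct i :=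
  PresentedGroup.toGroup.of _

/-- Every element of the Shephard group acts by a permutation of the coordinates, followed by
permutations of the points in each coordinate. -/
theorem exists_act_eq (g : (diagramB n p hp).ShephardGroup) :
    ∃ (τ : Equiv.Perm (Fin n)) (ε : Fin n → Equiv.Perm (PointSet p)),
      ∀ f i, act n p hp g f i = coordHom p (ε i) (f (τ i)) := by
  have hg : g ∈ Subgroup.closure (Set.range
      (PresentedGroup.of : Fin n → (diagramB n p hp).ShephardGroup)) := by
    rw [PresentedGroup.closure_range_of]
    trivial
  induction hg using Subgroup.closure_induction with
  | mem x hx =>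
    obtain ⟨i, rfl⟩ := hx
    rw [act_of]
    by_cases h : (i : ℕ) = 0
    · rw [genAct_zero h]
      exact ⟨1, fun j => if j = i then rot p else 1, fun f j => rfl⟩
    · rw [genAct_pos h]
      exact ⟨Equiv.swap (pred i) i, fun _ => 1, fun f j => by
        rw [permute_swap_apply, map_one, Equiv.Perm.one_apply]⟩
  | one => exact ⟨1, fun _ => 1, fun f j => by simp⟩
  | mul x y _ _ hx hy =>
    obtain ⟨τ, ε, h⟩ := hx
    obtain ⟨τ', ε', h'⟩ := hy
    exact ⟨τ' * τ, fun j => ε j * ε' (τ j), fun f j => by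
      rw [map_mul, Equiv.Perm.mul_apply, h, h', map_mul, Equiv.Perm.mul_apply,
        Equiv.Perm.mul_apply]⟩
  | inv x _ hx =>
    obtain ⟨τ, ε, h⟩ := hx
    refine ⟨τ⁻¹, fun j => (ε (τ⁻¹ j))⁻¹, fun f j => ?_⟩
    obtain ⟨f, rfl⟩ := (act n p hp x).surjective f
    have h1 : act n p hp x⁻¹ (act n p hp x f) = f := by
      rw [map_inv]
      exact (act n p hp x).symm_apply_apply f
    have h2 : τ (τ⁻¹ j) = j := τ.apply_symm_apply j
    rw [h1, h, h2, map_inv]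
    exact ((coordHom p (ε (τ⁻¹ j))).symm_apply_apply _).symm

theorem permute_mem_range (τ : Equiv.Perm (Fin n)) : permute τ ∈ (act n p hp).range := by
  rcases n with _ | n
  · have : τ = 1 := Subsingleton.elim _ _
    rw [this, map_one]
    exact one_mem _
  have h : τ ∈ Submonoid.closure
      (Set.range fun i : Fin n => Equiv.swap i.castSucc i.succ) := by
    rw [Equiv.Perm.mclosure_swap_castSucc_succ]
    trivial
  induction h using Submonoid.closure_induction with
  | mem x hx =>
    obtain ⟨i, rfl⟩ := hx
    refine ⟨PresentedGroup.of i.succ, ?_⟩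
    rw [act_of, genAct_pos (by simp)]
    congr 2
  | one => rw [map_one]; exact one_mem _
  | mul x y _ _ hx hy => rw [map_mul]; exact mul_mem hx hy

theorem rotAt_mem_range (i : Fin n) (k : ℤ) : rotAt i (rot p ^ k) ∈ (act n p hp).range := by
  have hn : 0 < n := i.pos
  set o : Fin n := ⟨0, hn⟩ with ho
  have h1 : rotAt (p := p) i (rot p ^ k) =
      permute (Equiv.swap o i) * rotAt o (rot p ^ k) * permute (Equiv.swap o i) := by
    ext f : 1
    funext j
    simp only [Equiv.Perm.mul_apply, rotAt_apply, permute_swap_apply, Equiv.swap_apply_self]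
    have e : Equiv.swap o i j = o ↔ j = i := by
      rw [Equiv.swap_apply_eq_iff, Equiv.swap_apply_left]
    simp only [e]
  rw [h1, map_zpow]
  refine mul_mem (mul_mem (permute_mem_range _) (zpow_mem ?_ k)) (permute_mem_range _)
  exact ⟨PresentedGroup.of o, by rw [act_of, genAct_zero rfl]⟩

/-- The action realizes every permutation of the coordinates together with transformations of the
points that take prescribed values at one point in each coordinate. -/
theorem exists_act_of_perm (τ : Equiv.Perm (Fin n)) (x : Fin n → PointSet p)
    (a : Fin n → PointSet p) :
    ∃ (g : (diagramB n p hp).ShephardGroup) (ε : Fin n → Equiv.Perm (PointSet p)),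
      (∀ i, ε i (x i) = a i) ∧ ∀ f i, act n p hp g f i = coordHom p (ε i) (f (τ i)) := by
  choose k hk using fun i => exists_rot_zpow hp (x i) (a i)
  -- Rotations in the coordinates of a finite set, one coordinate at a time.
  have hF : ∀ F : Finset (Fin n), ∃ g, ∀ f i, act n p hp g f i =
      coordHom p (if i ∈ F then rot p ^ k i else 1) (f i) := by
    intro F
    induction F using Finset.induction_on with
    | empty => exact ⟨1, fun f i => by simp⟩
    | insert j F hj ih =>
      obtain ⟨g, hg⟩ := ih
      obtain ⟨g', hg'⟩ := rotAt_mem_range (hp := hp) j (k j)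
      refine ⟨g' * g, fun f i => ?_⟩
      rw [map_mul, Equiv.Perm.mul_apply, hg', rotAt_apply, hg, ← Equiv.Perm.mul_apply, ← map_mul]
      by_cases hij : i = j
      · simp [hij, hj]
      · simp [hij]
  obtain ⟨g, hg⟩ := hF Finset.univ
  obtain ⟨g', hg'⟩ := permute_mem_range (hp := hp) (τ⁻¹)
  refine ⟨g * g', fun i => rot p ^ k i, hk, fun f i => ?_⟩
  rw [map_mul, Equiv.Perm.mul_apply, hg, hg', permute_apply, if_pos (Finset.mem_univ _), inv_inv]

end MonomialAction

/-! ### Orthonormal coordinates on the simplex -/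

namespace MonomialAction

variable {n p : ℕ} {hp : 2 ≤ p}

/-- The simple roots of type `B_n` in `ℝⁿ`, normalized to length one: the first standard basis
vector and the normalized differences of consecutive standard basis vectors. -/
def rootVec (i : Fin n) : Fin n → ℝ :=
  if (i : ℕ) = 0 then Pi.single i 1
  else (Real.sqrt 2)⁻¹ • (Pi.single i 1 - Pi.single (pred i) 1)

theorem sum_mul_rootVec (v : Fin n → ℝ) (i : Fin n) :
    ∑ k, v k * rootVec i k =
      if (i : ℕ) = 0 then v i else (Real.sqrt 2)⁻¹ * (v i - v (pred i)) := by
  unfold rootVec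
  split_ifs
  · simp [Pi.single_apply]
  · have : ∀ k, v k * ((Real.sqrt 2)⁻¹ • (Pi.single i 1 - Pi.single (pred i) 1 : Fin n → ℝ)) k =
        (Real.sqrt 2)⁻¹ * (v k * (Pi.single i 1 : Fin n → ℝ) k -
          v k * (Pi.single (pred i) 1 : Fin n → ℝ) k) := fun k => by
      simp only [Pi.smul_apply, Pi.sub_apply, smul_eq_mul]; ring
    simp only [this, ← Finset.mul_sum, Finset.sum_sub_distrib]
    simp [Pi.single_apply]

theorem val_pred (i : Fin n) : (pred i : ℕ) = i - 1 := rfl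

theorem pred_ne {i : Fin n} (h : (i : ℕ) ≠ 0) : pred i ≠ i := fun e => by
  have := congrArg Fin.val e
  rw [val_pred] at this
  omega

theorem inv_sqrt_two_mul_self : (Real.sqrt 2)⁻¹ * (Real.sqrt 2)⁻¹ = 2⁻¹ := by
  rw [← mul_inv, Real.mul_self_sqrt zero_le_two]

theorem gram_rootVec_of_lt (hp : 2 ≤ p) {i j : Fin n} (hij : i < j) :
    ∑ k, rootVec i k * rootVec j k =
      -Real.cos (Real.pi / ((diagramB n p hp).m i j : ℝ)) := by
  have hlt : (i : ℕ) < j := hij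
  have hj : (j : ℕ) ≠ 0 := by omega
  rw [sum_mul_rootVec, if_neg hj]
  have e1 : rootVec i j = 0 := by
    unfold rootVec
    have h2 : pred i ≠ j := fun e => by
      have := congrArg Fin.val e
      rw [val_pred] at this
      omega
    split_ifs <;> simp [hij.ne', h2.symm]
  rcases Nat.eq_or_lt_of_le (Nat.succ_le_of_lt hlt) with h | h
  · have hpj : pred j = i := Fin.ext (by rw [val_pred]; omega)
    rw [e1, hpj]
    by_cases h0 : (i : ℕ) = 0
    · rw [diagramB_four h h0, rootVec, if_pos h0, Pi.single_eq_same]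
      norm_num [Real.cos_pi_div_four]
      rw [← Real.sqrt_div_self]
    · rw [diagramB_three h h0, rootVec, if_neg h0]
      simp only [Pi.smul_apply, Pi.sub_apply, Pi.single_eq_same, smul_eq_mul,
        Pi.single_eq_of_ne (pred_ne h0).symm]
      push_cast
      rw [Real.cos_pi_div_three, sub_zero, mul_one, zero_sub, mul_neg, inv_sqrt_two_mul_self]
      norm_num
  · have e2 : rootVec i (pred j) = 0 := by
      unfold rootVec
      have h1 : i ≠ pred j := fun e => by
        have := congrArg Fin.val e
        rw [val_pred] at this
        omega
      have h2 : pred i ≠ pred j := fun e => by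
        have := congrArg Fin.val e
        rw [val_pred, val_pred] at this
        omega
      split_ifs <;> simp [h1.symm, h2.symm]
    rw [diagramB_two h, e1, e2]
    simp

theorem gram_rootVec (hp : 2 ≤ p) (i j : Fin n) :
    ∑ k, rootVec i k * rootVec j k =
      -Real.cos (Real.pi / ((diagramB n p hp).m i j : ℝ)) := by
  rcases lt_trichotomy i j with h | rfl | h
  · exact gram_rootVec_of_lt hp h
  · rw [(diagramB n p hp).m.diagonal, sum_mul_rootVec]
    split_ifs with h0
    · simp [rootVec, h0]
    · simp only [rootVec, h0, if_false, Pi.smul_apply, Pi.sub_apply, Pi.single_eq_same,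
        smul_eq_mul, Pi.single_eq_of_ne (pred_ne h0).symm, Pi.single_eq_of_ne (pred_ne h0)]
      have := inv_sqrt_two_mul_self
      rw [Nat.cast_one, div_one, Real.cos_pi, neg_neg]
      linarith
  · rw [(diagramB n p hp).m.symmetric, ← gram_rootVec_of_lt hp h]
    exact Finset.sum_congr rfl fun k _ => mul_comm _ _

/-- The linear map sending the `i`-th standard basis vector to the `i`-th simple root. It carries
the canonical form of the Coxeter group to the standard inner product of `ℝⁿ`. -/
def coord (n : ℕ) : (Fin n → ℝ) →ₗ[ℝ] (Fin n → ℝ) := Fintype.linearCombination ℝ rootVec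

theorem coord_apply (x : Fin n → ℝ) (k : Fin n) : coord n x k = ∑ i, x i * rootVec i k := by
  simp [coord, Fintype.linearCombination_apply]

theorem cosForm_eq (x y : Fin n → ℝ) :
    (diagramB n p hp).cosForm x y = ∑ k, coord n x k * coord n y k := by
  simp only [coord_apply, Finset.sum_mul_sum]
  simp only [ExtendedCoxeterDiagram.cosForm, ← gram_rootVec hp, Finset.mul_sum]
  symm
  rw [Finset.sum_comm]
  refine Finset.sum_congr rfl fun i _ => ?_
  rw [Finset.sum_comm]
  refine Finset.sum_congr rfl fun j _ => Finset.sum_congr rfl fun k _ => ?_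
  ring

theorem coord_single (i : Fin n) : coord n (Pi.single i 1) = rootVec i := by
  simp [coord]

theorem wall_eq (x : Fin n → ℝ) (i : Fin n) :
    (diagramB n p hp).wall x i =
      if (i : ℕ) = 0 then coord n x i
      else (Real.sqrt 2)⁻¹ * (coord n x i - coord n x (pred i)) := by
  rw [ExtendedCoxeterDiagram.wall, cosForm_eq, coord_single, sum_mul_rootVec]

/-- The simple roots span `ℝⁿ`: they successively yield all standard basis vectors. -/
theorem coord_surjective : Function.Surjective (coord n) := by
  rw [← LinearMap.range_eq_top, eq_top_iff]
  have h : ∀ (k : ℕ) (hk : k < n),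
      (Pi.single ⟨k, hk⟩ 1 : Fin n → ℝ) ∈ LinearMap.range (coord n) := by
    intro k
    induction k with
    | zero =>
      intro hk
      exact ⟨Pi.single ⟨0, hk⟩ 1, by rw [coord_single, rootVec, if_pos rfl]⟩
    | succ k ih =>
      intro hk
      have e : (Pi.single ⟨k + 1, hk⟩ 1 : Fin n → ℝ) =
          Real.sqrt 2 • coord n (Pi.single ⟨k + 1, hk⟩ 1) + Pi.single ⟨k, by omega⟩ 1 := by
        rw [coord_single, rootVec, if_neg (Nat.succ_ne_zero k), smul_smul,
          mul_inv_cancel₀ (by positivity), one_smul]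
        simp [pred]
      rw [e]
      exact add_mem (Submodule.smul_mem _ _ ⟨_, rfl⟩) (ih _)
  intro y _
  have hy : y = ∑ i, y i • (Pi.single i 1 : Fin n → ℝ) := by
    ext k
    simp [Pi.single_apply]
  rw [hy]
  exact sum_mem fun i _ => Submodule.smul_mem _ _ (h i i.2)

theorem coord_injective : Function.Injective (coord n) :=
  LinearMap.injective_iff_surjective.2 coord_surjective

theorem monotone_of_pred_le {y : Fin n → ℝ} (h : ∀ i : Fin n, (i : ℕ) ≠ 0 → y (pred i) ≤ y i) :
    Monotone y := by
  have key : ∀ (d k : ℕ) (hk : k + d < n), y ⟨k, by omega⟩ ≤ y ⟨k + d, hk⟩ := by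
    intro d
    induction d with
    | zero => intro k hk; exact le_rfl
    | succ d ih =>
      intro k hk
      exact (ih k (by omega)).trans (h ⟨k + (d + 1), hk⟩ (by simp))
  intro i j hij
  have hij' : (i : ℕ) ≤ j := hij
  have := key (j - i) i (by omega)
  have e : (⟨i + (j - i), by omega⟩ : Fin n) = j := Fin.ext (by simp; omega)
  rwa [e] at this

/-- The orthonormal coordinates of a point of the simplex. -/
abbrev ycoord (x : (diagramB n p hp).Simplex) : Fin n → ℝ := coord n x.1

theorem ycoord_sum_sq (x : (diagramB n p hp).Simplex) : ∑ k, ycoord x k ^ 2 = 1 := by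
  rw [← x.2.1, cosForm_eq]
  exact Finset.sum_congr rfl fun k _ => sq _

theorem ycoord_mono (x : (diagramB n p hp).Simplex) : Monotone (ycoord x) := by
  refine monotone_of_pred_le fun i hi => ?_
  have h := x.2.2 i
  rw [wall_eq, if_neg hi] at h
  exact sub_nonneg.1 (nonneg_of_mul_nonneg_right h (by positivity))

theorem ycoord_nonneg (x : (diagramB n p hp).Simplex) (i : Fin n) : 0 ≤ ycoord x i := by
  have h := x.2.2 ⟨0, i.pos⟩
  rw [wall_eq, if_pos rfl] at h
  exact h.trans (ycoord_mono x (Nat.zero_le _))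

theorem ycoord_injective : Function.Injective (ycoord (n := n) (hp := hp)) := fun _ _ h =>
  Subtype.ext (coord_injective h)

theorem exists_simplex {y : Fin n → ℝ} (h0 : ∀ i, 0 ≤ y i) (hm : Monotone y)
    (h1 : ∑ i, y i ^ 2 = 1) : ∃ x : (diagramB n p hp).Simplex, ycoord x = y := by
  obtain ⟨x, rfl⟩ := coord_surjective y
  refine ⟨⟨x, ?_, fun i => ?_⟩, rfl⟩
  · rw [cosForm_eq, ← h1]
    exact Finset.sum_congr rfl fun k _ => (sq _).symm
  · rw [wall_eq]
    split_ifs with h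
    · exact h0 i
    · exact mul_nonneg (by positivity) (sub_nonneg.2 (hm (by
        change (pred i : ℕ) ≤ i; rw [val_pred]; omega)))

theorem wall_eq_zero_iff (x : Fin n → ℝ) (i : Fin n) :
    (diagramB n p hp).wall x i = 0 ↔
      if (i : ℕ) = 0 then coord n x i = 0 else coord n x (pred i) = coord n x i := by
  rw [wall_eq]
  split_ifs
  · rfl
  · have : (Real.sqrt 2)⁻¹ ≠ 0 := by positivity
    rw [mul_eq_zero, or_iff_right this, sub_eq_zero, eq_comm]

/-! ### Stabilizers -/

/-- The base point of the set of `p` points. -/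
def basePt {p : ℕ} (h : 2 ≤ p) : PointSet p :=
  (⟨0, Nat.lt_of_lt_of_le Nat.zero_lt_two h⟩ : Fin p)

/-- The point of the join given by a point of the simplex, as a vector of coordinate data. All
its recorded points are the base point. -/
def iota (x : (diagramB n p hp).Simplex) (i : Fin n) : Coord p :=
  (ycoord x i, if ycoord x i = 0 then none else some (basePt hp))

/-- The generators of the Shephard group, continued by `1`. -/
def gen (n p : ℕ) (hp : 2 ≤ p) (k : ℕ) : (diagramB n p hp).ShephardGroup :=
  if h : k < n then PresentedGroup.of ⟨k, h⟩ else 1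

theorem gen_of_lt {k : ℕ} (h : k < n) : gen n p hp k = PresentedGroup.of ⟨k, h⟩ := dif_pos h

theorem gen_of_le {k : ℕ} (h : n ≤ k) : gen n p hp k = 1 := dif_neg (not_lt.2 h)

theorem of_pow (i : Fin n) :
    (PresentedGroup.of i : (diagramB n p hp).ShephardGroup) ^ (diagramB n p hp).p i = 1 :=
  PresentedGroup.one_of_mem (rels := (diagramB n p hp).relators) (Or.inl ⟨i, rfl⟩)

theorem of_braid (i j : Fin n) :
    altProd (PresentedGroup.of i : (diagramB n p hp).ShephardGroup) (PresentedGroup.of j)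
        ((diagramB n p hp).m i j) =
      altProd (PresentedGroup.of j) (PresentedGroup.of i) ((diagramB n p hp).m i j) := by
  have h := PresentedGroup.one_of_mem (rels := (diagramB n p hp).relators)
    (Or.inr ⟨i, j, rfl⟩)
  rw [map_mul, map_inv, map_altProd, map_altProd, mul_inv_eq_one] at h
  exact h

theorem gen_zero_pow : gen n p hp 0 ^ p = 1 := by
  rcases Nat.eq_zero_or_pos n with h | h
  · rw [gen_of_le h.le, one_pow]
  · rw [gen_of_lt h]
    exact of_pow (hp := hp) ⟨0, h⟩

theorem braidB_gen : BraidB n (gen n p hp) where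
  mul_self j hj := by
    by_cases h : j < n
    · have e := of_pow (hp := hp) ⟨j, h⟩
      have e2 : (diagramB n p hp).p ⟨j, h⟩ = 2 := if_neg (by simp; omega)
      rw [e2, pow_two] at e
      rw [gen_of_lt h, e]
    · rw [gen_of_le (not_lt.1 h), one_mul]
  braid_four := by
    by_cases h : 1 < n
    · have e := of_braid (hp := hp) ⟨0, by omega⟩ ⟨1, h⟩
      rw [diagramB_four rfl rfl, altProd_four, altProd_four] at e
      rw [gen_of_lt h, gen_of_lt (by omega), e]
    · rw [gen_of_le (k := 1) (not_lt.1 h)]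
      simp
  braid_three j hj hjn := by
    have e := of_braid (hp := hp) ⟨j, by omega⟩ ⟨j + 1, hjn⟩
    rw [diagramB_three rfl (by simp; omega), altProd_three, altProd_three] at e
    rw [gen_of_lt hjn, gen_of_lt (by omega), e]
  comm i j hij := by
    by_cases h : j < n
    · have e := of_braid (hp := hp) ⟨i, by omega⟩ ⟨j, h⟩
      rw [diagramB_two hij, altProd_two, altProd_two] at e
      rw [gen_of_lt h, gen_of_lt (by omega)]
      exact e
    · rw [gen_of_le (not_lt.1 h)]
      exact Commute.one_right _

theorem initialSubgroup_gen : initialSubgroup (gen n p hp) n = ⊤ := by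
  rw [eq_top_iff, ← PresentedGroup.closure_range_of, Subgroup.closure_le]
  rintro _ ⟨i, rfl⟩
  have h := BraidB.mem_initialSubgroup (s := gen n p hp) i.2
  rwa [gen_of_lt i.2] at h

theorem act_gen_succ {k : ℕ} (h : k + 1 < n) (f : Fin n → Coord p) (i : Fin n) :
    act n p hp (gen n p hp (k + 1)) f i =
      f (Equiv.swap ⟨k, by omega⟩ ⟨k + 1, h⟩ i) := by
  rw [gen_of_lt h, act_of, genAct_pos (Nat.succ_ne_zero k), permute_swap_apply]
  rfl

theorem act_upProd {m : ℕ} (h : m < n) (f : Fin n → Coord p) :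
    act n p hp (upProd (gen n p hp) m) f ⟨0, by omega⟩ = f ⟨m, h⟩ := by
  induction m generalizing f with
  | zero => simp [upProd]
  | succ m ih =>
    rw [upProd, map_mul, Equiv.Perm.mul_apply, ih (by omega), act_gen_succ h,
      Equiv.swap_apply_left]

theorem act_upProd_inv {m : ℕ} (h : m < n) (f : Fin n → Coord p) :
    act n p hp (upProd (gen n p hp) m)⁻¹ f ⟨m, h⟩ = f ⟨0, by omega⟩ := by
  rw [← act_upProd (hp := hp) h (act n p hp (upProd (gen n p hp) m)⁻¹ f),
    ← Equiv.Perm.mul_apply, ← map_mul, mul_inv_cancel, map_one,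
    Equiv.Perm.one_apply]

theorem act_gen_zero_zpow (h : 0 < n) (a : ℤ) (f : Fin n → Coord p) :
    act n p hp (gen n p hp 0 ^ a) f ⟨0, h⟩ = coordHom p (rot p ^ a) (f ⟨0, h⟩) := by
  rw [gen_of_lt h, map_zpow, act_of, genAct_zero rfl, ← map_zpow, rotAt_apply, if_pos rfl]

theorem act_initialSubgroup {m : ℕ} (h : m < n) {g : (diagramB n p hp).ShephardGroup}
    (hg : g ∈ initialSubgroup (gen n p hp) m) (f : Fin n → Coord p) :
    act n p hp g f ⟨m, h⟩ = f ⟨m, h⟩ := by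
  induction hg using Subgroup.closure_induction generalizing f with
  | mem x hx =>
    obtain ⟨j, hj, rfl⟩ := hx
    have hj' : j < m := hj
    rcases j with _ | j
    · rw [gen_of_lt (by omega), act_of, genAct_zero rfl, rotAt_apply, if_neg, map_one,
        Equiv.Perm.one_apply]
      simp only [Fin.mk.injEq]
      omega
    · rw [act_gen_succ (by omega), Equiv.swap_apply_of_ne_of_ne] <;>
        simp only [ne_eq, Fin.mk.injEq] <;> omega
  | one => rw [map_one, Equiv.Perm.one_apply]
  | mul x y _ _ hx hy => rw [map_mul, Equiv.Perm.mul_apply, hx, hy]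
  | inv x _ hx =>
    rw [← hx (act n p hp x⁻¹ f), ← Equiv.Perm.mul_apply, ← map_mul, mul_inv_cancel, map_one,
      Equiv.Perm.one_apply]

theorem gen_mem_localGroup {x : (diagramB n p hp).Simplex} {j : ℕ} (h : j < n)
    (hj : (diagramB n p hp).wall x.1 ⟨j, h⟩ = 0) :
    gen n p hp j ∈ (diagramB n p hp).localGroup x := by
  rw [gen_of_lt h]
  exact Subgroup.subset_closure ⟨⟨j, h⟩, hj, rfl⟩

theorem act_iota_of_mem {x : (diagramB n p hp).Simplex} {g : (diagramB n p hp).ShephardGroup}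
    (hg : g ∈ (diagramB n p hp).localGroup x) : act n p hp g (iota x) = iota x := by
  induction hg using Subgroup.closure_induction with
  | mem g hg =>
    obtain ⟨i, hi, rfl⟩ := hg
    have hi' := (wall_eq_zero_iff (hp := hp) x.1 i).1 hi
    rw [act_of]
    by_cases h : (i : ℕ) = 0
    · rw [if_pos h] at hi'
      rw [genAct_zero h]
      funext j
      rw [rotAt_apply]
      by_cases hj : j = i
      · rw [hj, if_pos rfl, coordHom_apply]
        simp [iota, ycoord, hi']
      · rw [if_neg hj, map_one, Equiv.Perm.one_apply]
    · rw [if_neg h] at hi'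
      rw [genAct_pos h]
      have e : iota x (pred i) = iota x i := by simp [iota, ycoord, hi']
      funext j
      rw [permute_swap_apply]
      by_cases h1 : j = pred i
      · rw [h1, Equiv.swap_apply_left, e]
      · by_cases h2 : j = i
        · rw [h2, Equiv.swap_apply_right, e]
        · rw [Equiv.swap_apply_of_ne_of_ne h1 h2]
  | one => rw [map_one, Equiv.Perm.one_apply]
  | mul g g' _ _ hg hg' => rw [map_mul, Equiv.Perm.mul_apply, hg', hg]
  | inv g _ hg =>
    conv_lhs => rw [← hg]
    rw [← Equiv.Perm.mul_apply, ← map_mul, inv_mul_cancel, map_one, Equiv.Perm.one_apply]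

theorem upProd_inv_mul_mem {G : Type} [Group G] {s : ℕ → G} {H : Subgroup G} {i m : ℕ}
    (him : i ≤ m) (h : ∀ j, i < j → j ≤ m → s j ∈ H) : (upProd s i)⁻¹ * upProd s m ∈ H := by
  induction m, him using Nat.le_induction with
  | base => rw [inv_mul_cancel]; exact one_mem H
  | succ m him ih =>
    rw [upProd, ← mul_assoc]
    exact mul_mem (ih fun j hj hjm => h j hj (by omega)) (h _ (by omega) le_rfl)

theorem upProd_mem {G : Type} [Group G] {s : ℕ → G} {H : Subgroup G} {m : ℕ}
    (h : ∀ j, j ≤ m → s j ∈ H) : upProd s m ∈ H := by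
  have := upProd_inv_mul_mem (s := s) (Nat.zero_le m) fun j _ hj => h j hj
  simpa [upProd] using this

/-- The stabilizer of a point of the fundamental chamber is generated by the generators that fix
it: an element of `⟨s 0, …, s m⟩` is brought into `⟨s 0, …, s (m - 1)⟩` by means of the coset
representatives, whose effect on the `m`-th coordinate is known. -/
theorem mem_localGroup_of_act {x : (diagramB n p hp).Simplex} {k : ℕ} (hk : k ≤ n)
    {g : (diagramB n p hp).ShephardGroup} (hg : g ∈ initialSubgroup (gen n p hp) k)
    (h : act n p hp g (iota x) = iota x) : g ∈ (diagramB n p hp).localGroup x := by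
  induction k generalizing g with
  | zero =>
    have : g = 1 := by
      simpa [initialSubgroup] using hg
    rw [this]
    exact one_mem _
  | succ m ih =>
    have hmn : m < n := hk
    obtain ⟨i, him, a, g', hg', rfl⟩ := braidB_gen.exists_coset hmn hg
    have hin : i < n := by omega
    have e : iota x ⟨i, hin⟩ = coordHom p (rot p ^ a) (iota x ⟨m, hmn⟩) := by
      conv_lhs => rw [← h]
      rw [map_mul, map_mul, map_mul, Equiv.Perm.mul_apply, Equiv.Perm.mul_apply,
        Equiv.Perm.mul_apply, act_upProd_inv hin, act_gen_zero_zpow, act_upProd hmn,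
        act_initialSubgroup hmn hg']
    rw [coordHom_apply] at e
    have e1 : ycoord x ⟨i, hin⟩ = ycoord x ⟨m, hmn⟩ := congrArg Prod.fst e
    have e2 : (if ycoord x ⟨i, hin⟩ = 0 then none else some (basePt hp)) =
        (if ycoord x ⟨m, hmn⟩ = 0 then none else some (basePt hp)).map (rot p ^ a) :=
      congrArg Prod.snd e
    have hmono := ycoord_mono x
    have hrep : (upProd (gen n p hp) i)⁻¹ * gen n p hp 0 ^ a * upProd (gen n p hp) m ∈
        (diagramB n p hp).localGroup x := by
      by_cases h0 : ycoord x ⟨m, hmn⟩ = 0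
      · have hz : ∀ j (hj : j ≤ m), ycoord x ⟨j, by omega⟩ = 0 := fun j hj =>
          le_antisymm (h0 ▸ hmono (show (⟨j, by omega⟩ : Fin n) ≤ ⟨m, hmn⟩ from hj))
            (ycoord_nonneg x _)
        have hall : ∀ j ≤ m, gen n p hp j ∈ (diagramB n p hp).localGroup x := fun j hj => by
          refine gen_mem_localGroup (by omega) ?_
          rw [wall_eq_zero_iff]
          split_ifs with hj0
          · exact hz j hj
          · exact (hz (j - 1) (by omega)).trans (hz j hj).symm
        exact mul_mem (mul_mem (inv_mem (upProd_mem fun j hj => hall j (by omega)))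
          (zpow_mem (hall 0 (Nat.zero_le _)) a)) (upProd_mem hall)
      · rw [e1, if_neg h0, Option.map_some, Option.some_inj] at e2
        obtain ⟨b, rfl⟩ := dvd_of_rot_zpow_apply hp e2.symm
        rw [zpow_mul, zpow_natCast, gen_zero_pow, one_zpow, mul_one]
        refine upProd_inv_mul_mem him fun j hij hjm => gen_mem_localGroup (by omega) ?_
        rw [wall_eq_zero_iff, if_neg (by simp; omega)]
        have b1 : ycoord x ⟨i, hin⟩ ≤ ycoord x (pred ⟨j, by omega⟩) :=
          hmono (show i ≤ j - 1 by omega)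
        have b2 : ycoord x (pred ⟨j, by omega⟩) ≤ ycoord x ⟨j, by omega⟩ :=
          hmono (show j - 1 ≤ j by omega)
        have b3 : ycoord x ⟨j, by omega⟩ ≤ ycoord x ⟨m, hmn⟩ := hmono (show j ≤ m from hjm)
        change ycoord x _ = ycoord x _
        linarith
    refine mul_mem hrep (ih (by omega) hg' ?_)
    rw [map_mul, Equiv.Perm.mul_apply] at h
    have h' := act_iota_of_mem hrep
    exact (act n p hp _).injective (h.trans h'.symm)

end MonomialAction

namespace MonomialAction

open SphericalJoin

variable {n p : ℕ} {hp : 2 ≤ p}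

/-! ### The bijection onto the join -/

/-- The action of `g` is the permutation `τ` of the coordinates followed by the permutations `ε i`
of the points. -/
def ActsBy (g : (diagramB n p hp).ShephardGroup) (τ : Equiv.Perm (Fin n))
    (ε : Fin n → Equiv.Perm (PointSet p)) : Prop :=
  ∀ f i, act n p hp g f i = coordHom p (ε i) (f (τ i))

/-- The image under `g` of a point of the fundamental chamber of the join. -/
def toJoin (x : (diagramB n p hp).Simplex) (g : (diagramB n p hp).ShephardGroup) :
    SphericalJoin n (PointSet p) where
  wt i := (act n p hp g (iota x) i).1
  pt i := (act n p hp g (iota x) i).2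
  wt_nonneg i := by
    obtain ⟨τ, ε, h⟩ := exists_act_eq g
    rw [h]
    exact ycoord_nonneg x (τ i)
  sum_sq := by
    obtain ⟨τ, ε, h⟩ := exists_act_eq g
    simp only [h]
    exact (Equiv.sum_comp τ fun i => ycoord x i ^ 2).trans (ycoord_sum_sq x)
  pt_eq_none i := by
    obtain ⟨τ, ε, h⟩ := exists_act_eq g
    rw [h, coordHom_apply]
    simp [iota]

theorem toJoin_wt {g : (diagramB n p hp).ShephardGroup} {τ : Equiv.Perm (Fin n)}
    {ε : Fin n → Equiv.Perm (PointSet p)} (h : ActsBy g τ ε)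
    (x : (diagramB n p hp).Simplex) (i : Fin n) : (toJoin x g).wt i = ycoord x (τ i) := by
  change (act n p hp g (iota x) i).1 = _
  rw [h]
  rfl

theorem toJoin_pt {g : (diagramB n p hp).ShephardGroup} {τ : Equiv.Perm (Fin n)}
    {ε : Fin n → Equiv.Perm (PointSet p)} (h : ActsBy g τ ε)
    (x : (diagramB n p hp).Simplex) (i : Fin n) :
    (toJoin x g).pt i = if ycoord x (τ i) = 0 then none else some (ε i (basePt hp)) := by
  change (act n p hp g (iota x) i).2 = _
  rw [h, coordHom_apply]
  by_cases h0 : ycoord x (τ i) = 0 <;> simp [iota, h0]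

theorem act_eq_of_toJoin_eq {x x' : (diagramB n p hp).Simplex}
    {g g' : (diagramB n p hp).ShephardGroup} (h : toJoin x g = toJoin x' g') :
    act n p hp g (iota x) = act n p hp g' (iota x') := by
  funext i
  exact Prod.ext (congrFun (congrArg SphericalJoin.wt h) i)
    (congrFun (congrArg SphericalJoin.pt h) i)

theorem simplex_eq_of_toJoin_eq {x x' : (diagramB n p hp).Simplex}
    {g g' : (diagramB n p hp).ShephardGroup} (h : toJoin x g = toJoin x' g') : x = x' := by
  obtain ⟨τ, ε, hτ⟩ := exists_act_eq g
  obtain ⟨τ', ε', hτ'⟩ := exists_act_eq g'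
  -- Both coordinate vectors are the increasing rearrangement of the weights.
  have e : ycoord x = ycoord x' ∘ (τ.symm.trans τ') := by
    funext i
    have := congrFun (congrArg SphericalJoin.wt h) (τ.symm i)
    rw [toJoin_wt hτ, toJoin_wt hτ', Equiv.apply_symm_apply] at this
    exact this
  refine ycoord_injective (e.trans ?_)
  have := Tuple.unique_monotone (f := ycoord x') (σ := τ.symm.trans τ') (τ := 1)
    (e ▸ ycoord_mono x) (ycoord_mono x')
  exact this

/-- The map from `Θ̂` to the join that sends the point `x` of the chamber `gΔ` to the image of `x`
under `g`. -/
def thetaToJoin (z : (diagramB n p hp).ThetaHat) : SphericalJoin n (PointSet p) :=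
  Quotient.lift (s := QuotientGroup.leftRel ((diagramB n p hp).localGroup z.1)) (toJoin z.1)
    (fun g g' hgg' => by
      have hmem : g⁻¹ * g' ∈ (diagramB n p hp).localGroup z.1 := QuotientGroup.leftRel_apply.1 hgg'
      have e : act n p hp g (iota z.1) = act n p hp g' (iota z.1) := by
        rw [← mul_inv_cancel_left g g', map_mul, Equiv.Perm.mul_apply, act_iota_of_mem hmem]
      ext1
      · funext i
        exact congrArg Prod.fst (congrFun e i)
      · funext i
        exact congrArg Prod.snd (congrFun e i)) z.2

/-- The point `x` of the chamber `gΔ`. -/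
def thetaPoint (x : (diagramB n p hp).Simplex) (g : (diagramB n p hp).ShephardGroup) :
    (diagramB n p hp).ThetaHat := ⟨x, QuotientGroup.mk g⟩

theorem thetaToJoin_mk (x : (diagramB n p hp).Simplex) (g : (diagramB n p hp).ShephardGroup) :
    thetaToJoin (thetaPoint x g) = toJoin x g := rfl

theorem thetaToJoin_of_mem_chamber {z : (diagramB n p hp).ThetaHat}
    {g : (diagramB n p hp).ShephardGroup} (h : z ∈ (diagramB n p hp).chamber g) :
    thetaToJoin z = toJoin z.1 g := by
  obtain ⟨x, q⟩ := z
  have hq : q = QuotientGroup.mk g := h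
  subst hq
  rfl

theorem thetaToJoin_injective : Function.Injective (thetaToJoin (n := n) (hp := hp)) := by
  rintro ⟨x, q⟩ ⟨x', q'⟩ h
  obtain ⟨g, rfl⟩ := QuotientGroup.mk_surjective q
  obtain ⟨g', rfl⟩ := QuotientGroup.mk_surjective q'
  change toJoin x g = toJoin x' g' at h
  obtain rfl := simplex_eq_of_toJoin_eq h
  have e := act_eq_of_toJoin_eq h
  have hmem : g⁻¹ * g' ∈ (diagramB n p hp).localGroup x := by
    refine mem_localGroup_of_act le_rfl (by rw [initialSubgroup_gen]; trivial) ?_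
    rw [map_mul, Equiv.Perm.mul_apply, ← e, ← Equiv.Perm.mul_apply, ← map_mul, inv_mul_cancel,
      map_one, Equiv.Perm.one_apply]
  rw [QuotientGroup.eq.2 hmem]

/-- The points of the join whose weights are sorted by `τ⁻¹` and whose recorded points are among
the `a i` lie in a common chamber. -/
theorem exists_chamber (τ : Equiv.Perm (Fin n)) (a : Fin n → PointSet p) :
    ∃ g : (diagramB n p hp).ShephardGroup, ∀ z : SphericalJoin n (PointSet p),
      Monotone (z.wt ∘ τ) → (∀ i, z.pt i = none ∨ z.pt i = some (a i)) →
      ∃ x, toJoin x g = z := by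
  obtain ⟨g, ε, hε, hg⟩ := exists_act_of_perm (hp := hp) τ.symm (fun _ => basePt hp) a
  refine ⟨g, fun z hz hza => ?_⟩
  obtain ⟨x, hx⟩ := exists_simplex (hp := hp) (y := z.wt ∘ τ) (fun i => z.wt_nonneg _) hz
    ((Equiv.sum_comp τ fun i => z.wt i ^ 2).trans z.sum_sq)
  have hxi : ∀ i, ycoord x (τ.symm i) = z.wt i := fun i => by
    rw [hx, Function.comp_apply, Equiv.apply_symm_apply]
  refine ⟨x, ?_⟩
  ext1
  · funext i
    rw [toJoin_wt hg, hxi]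
  · funext i
    rw [toJoin_pt hg, hxi, hε]
    by_cases h0 : z.wt i = 0
    · rw [if_pos h0, (z.pt_eq_none i).2 h0]
    · rw [if_neg h0, (hza i).resolve_left fun h => h0 ((z.pt_eq_none i).1 h)]

theorem thetaToJoin_surjective : Function.Surjective (thetaToJoin (n := n) (hp := hp)) := by
  intro z
  obtain ⟨g, hg⟩ := exists_chamber (hp := hp) (Tuple.sort z.wt)
    fun i => (z.pt i).getD (basePt hp)
  obtain ⟨x, hx⟩ := hg z (Tuple.monotone_sort z.wt) fun i => by rcases z.pt i <;> simp
  exact ⟨thetaPoint x g, hx⟩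

/-- The bijection from `Θ̂(B_n(p, 2))` to the `n`-fold join of `p` points. -/
def thetaEquiv (n p : ℕ) (hp : 2 ≤ p) :
    (diagramB n p hp).ThetaHat ≃ SphericalJoin n (PointSet p) :=
  Equiv.ofBijective thetaToJoin ⟨thetaToJoin_injective, thetaToJoin_surjective⟩

theorem thetaEquiv_apply (z : (diagramB n p hp).ThetaHat) :
    thetaEquiv n p hp z = thetaToJoin z := rfl

/-! ### The simplices of the barycentric subdivision -/

/-- The cell of the join whose barycenter is the image of the `i`-th vertex of the fundamental
chamber under an element that acts by `τ` and `ε`. -/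
def vertexCell (hp : 2 ≤ p) (τ : Equiv.Perm (Fin n)) (ε : Fin n → Equiv.Perm (PointSet p))
    (i k : Fin n) : Option (PointSet p) :=
  if i ≤ τ k then some (ε k (basePt hp)) else none

theorem vertexCell_eq_none (τ : Equiv.Perm (Fin n)) (ε : Fin n → Equiv.Perm (PointSet p))
    (i k : Fin n) : vertexCell hp τ ε i k = none ↔ ¬ i ≤ τ k := by
  simp [vertexCell]

theorem vertexCell_injective (τ : Equiv.Perm (Fin n)) (ε : Fin n → Equiv.Perm (PointSet p)) :
    Function.Injective (vertexCell hp τ ε) := by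
  have key : ∀ i j, vertexCell hp τ ε i = vertexCell hp τ ε j → j ≤ i := fun i j h => by
    by_contra hji
    have e : vertexCell hp τ ε j (τ.symm i) = none := by
      rw [vertexCell_eq_none, Equiv.apply_symm_apply]
      exact hji
    rw [← h, vertexCell_eq_none, Equiv.apply_symm_apply] at e
    exact e le_rfl
  exact fun i j h => le_antisymm (key j i h.symm) (key i j h)

theorem vertexCell_isFaceOf (τ : Equiv.Perm (Fin n)) (ε : Fin n → Equiv.Perm (PointSet p))
    {i j : Fin n} (hij : j ≤ i) : IsFaceOf (vertexCell hp τ ε i) (vertexCell hp τ ε j) := by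
  intro k
  by_cases h : i ≤ τ k
  · right
    rw [vertexCell, vertexCell, if_pos h, if_pos (hij.trans h)]
  · left
    exact if_neg h

theorem supp_vertexCell_nonempty (τ : Equiv.Perm (Fin n)) (ε : Fin n → Equiv.Perm (PointSet p))
    (i : Fin n) : (supp (vertexCell hp τ ε i)).Nonempty := by
  refine ⟨τ.symm i, ?_⟩
  rw [supp, Finset.mem_filter]
  refine ⟨Finset.mem_univ _, ?_⟩
  rw [ne_eq, vertexCell_eq_none, Equiv.apply_symm_apply, not_not]

/-- The nonzero weights of the barycenter of `vertexCell`. -/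
def vertexWt (hp : 2 ≤ p) (τ : Equiv.Perm (Fin n)) (ε : Fin n → Equiv.Perm (PointSet p))
    (i : Fin n) : ℝ := 1 / Real.sqrt (supp (vertexCell hp τ ε i)).card

theorem vertexWt_pos (τ : Equiv.Perm (Fin n)) (ε : Fin n → Equiv.Perm (PointSet p))
    (i : Fin n) : 0 < vertexWt hp τ ε i := by
  have := Finset.card_pos.2 (supp_vertexCell_nonempty (hp := hp) τ ε i)
  unfold vertexWt
  positivity

theorem baryWt_vertexCell (τ : Equiv.Perm (Fin n)) (ε : Fin n → Equiv.Perm (PointSet p))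
    (i k : Fin n) :
    baryWt (vertexCell hp τ ε i) k = if i ≤ τ k then vertexWt hp τ ε i else 0 := by
  by_cases h : i ≤ τ k
  · rw [baryWt, if_neg (by rw [vertexCell_eq_none, not_not]; exact h), if_pos h, vertexWt]
  · rw [baryWt, if_pos ((vertexCell_eq_none τ ε i k).2 h), if_neg h]

/-- The increments of a vector, starting from `0`. For the coordinates of a point of the simplex,
the `i`-th increment vanishes exactly if the point lies on the `i`-th wall. -/
def jump (y : Fin n → ℝ) (i : Fin n) : ℝ := if (i : ℕ) = 0 then y i else y i - y (pred i)

theorem sum_jump (y : Fin n → ℝ) (j : Fin n) : ∑ i, (if i ≤ j then jump y i else 0) = y j := by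
  obtain ⟨k, hk⟩ := j
  induction k with
  | zero =>
    rw [Finset.sum_eq_single ⟨0, hk⟩]
    · simp [jump]
    · intro i _ hi
      rw [if_neg fun h => hi (le_antisymm h (Nat.zero_le _))]
    · simp
  | succ k ih =>
    have h1 : ∀ i : Fin n, (if i ≤ ⟨k + 1, hk⟩ then jump y i else 0) =
        (if i ≤ ⟨k, by omega⟩ then jump y i else 0) +
          if i = ⟨k + 1, hk⟩ then jump y i else 0 := by
      intro i
      simp only [Fin.le_def, Fin.ext_iff]
      rcases lt_trichotomy (i : ℕ) (k + 1) with h | h | h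
      · rw [if_pos (by omega), if_pos (by omega), if_neg (by omega), add_zero]
      · rw [if_pos (by omega), if_neg (by omega), if_pos (by omega), zero_add]
      · rw [if_neg (by omega), if_neg (by omega), if_neg (by omega), add_zero]
    simp only [h1, Finset.sum_add_distrib, ih, Finset.sum_ite_eq', Finset.mem_univ, if_true]
    simp [jump, pred]

theorem jump_eq_zero_iff_wall (x : Fin n → ℝ) (i : Fin n) :
    jump (coord n x) i = 0 ↔ (diagramB n p hp).wall x i = 0 := by
  rw [wall_eq_zero_iff, jump]
  split_ifs
  · rfl
  · rw [sub_eq_zero, eq_comm]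

theorem jump_ycoord_nonneg (x : (diagramB n p hp).Simplex) (i : Fin n) :
    0 ≤ jump (ycoord x) i := by
  unfold jump
  split_ifs with h
  · exact ycoord_nonneg x i
  · exact sub_nonneg.2 (ycoord_mono x (show (i : ℕ) - 1 ≤ i by omega))

open Classical in
/-- The closed simplex `gσ_T` corresponds to the simplex spanned by the barycenters of the cells
`vertexCell i` with `i ∈ T`: the coefficients of a point in terms of these barycenters are the
increments of its sorted weights, up to normalization. -/
theorem image_face {g : (diagramB n p hp).ShephardGroup} {τ : Equiv.Perm (Fin n)}
    {ε : Fin n → Equiv.Perm (PointSet p)} (hg : ActsBy g τ ε) {T : Finset (Fin n)}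
    (hT : T.Nonempty) :
    thetaEquiv n p hp '' (diagramB n p hp).face g T =
      barySimplex (T.image (vertexCell hp τ ε)) := by
  have inj := vertexCell_injective (hp := hp) τ ε
  ext z
  constructor
  · rintro ⟨w, ⟨hq, hw⟩, rfl⟩
    rw [thetaEquiv_apply, thetaToJoin_of_mem_chamber hq]
    generalize w.1 = x at hw
    have hsum : ∀ j, ycoord x j = ∑ i ∈ T, if i ≤ j then jump (ycoord x) i else 0 := by
      intro j
      rw [← sum_jump (ycoord x) j]
      symm
      refine Finset.sum_subset (Finset.subset_univ _) fun i _ hi => ?_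
      rw [(jump_eq_zero_iff_wall x.1 i).2 (hw i hi), ite_self]
    refine ⟨?_, Function.extend (vertexCell hp τ ε)
      (fun i => jump (ycoord x) i / vertexWt hp τ ε i) 0, fun c => ?_, fun k => ?_⟩
    · refine ⟨_, Finset.mem_image_of_mem _ (T.min'_mem hT), fun k => ?_⟩
      rw [toJoin_pt hg]
      by_cases h0 : ycoord x (τ k) = 0
      · exact Or.inl (if_pos h0)
      · right
        rw [if_neg h0, vertexCell, if_pos]
        rw [hsum] at h0
        obtain ⟨i, hi, hi0⟩ := Finset.exists_ne_zero_of_sum_ne_zero h0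
        exact (T.min'_le i hi).trans (by by_contra h; exact hi0 (if_neg h))
    · by_cases h : ∃ i, vertexCell hp τ ε i = c
      · obtain ⟨i, rfl⟩ := h
        rw [inj.extend_apply]
        exact div_nonneg (jump_ycoord_nonneg x i) (vertexWt_pos τ ε i).le
      · rw [Function.extend_apply' _ _ _ h]
        exact le_rfl
    · rw [toJoin_wt hg, hsum, Finset.sum_image fun i _ j _ h => inj h]
      refine Finset.sum_congr rfl fun i _ => ?_
      rw [inj.extend_apply, baryWt_vertexCell, mul_ite, mul_zero,
        div_mul_cancel₀ _ (vertexWt_pos τ ε i).ne']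
  · rintro ⟨⟨c, hc, hzc⟩, a, ha0, ha⟩
    obtain ⟨i₁, hi₁, rfl⟩ := Finset.mem_image.1 hc
    set b : Fin n → ℝ := fun i => a (vertexCell hp τ ε i) * vertexWt hp τ ε i with hb
    have hb0 : ∀ i, 0 ≤ b i := fun i => mul_nonneg (ha0 _) (vertexWt_pos τ ε i).le
    set y : Fin n → ℝ := fun j => ∑ i ∈ T, if i ≤ j then b i else 0 with hy
    have hzy : ∀ k, z.wt k = y (τ k) := fun k => by
      rw [ha, Finset.sum_image fun i _ j _ h => inj h]
      refine Finset.sum_congr rfl fun i _ => ?_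
      rw [baryWt_vertexCell, mul_ite, mul_zero]
    have hy0 : ∀ i, 0 ≤ y i := fun j => Finset.sum_nonneg fun i _ => by
      split_ifs
      · exact hb0 i
      · exact le_rfl
    have hym : Monotone y := fun j j' hjj' => Finset.sum_le_sum fun i _ => by
      by_cases h : i ≤ j
      · rw [if_pos h, if_pos (h.trans hjj')]
      · rw [if_neg h]
        split_ifs
        · exact hb0 i
        · exact le_rfl
    obtain ⟨x, hx⟩ := exists_simplex (hp := hp) hy0 hym (by
      rw [← Equiv.sum_comp τ, ← z.sum_sq]
      exact Finset.sum_congr rfl fun k _ => by rw [hzy])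
    refine ⟨thetaPoint x g, ⟨rfl, fun i hi => ?_⟩, ?_⟩
    · change (diagramB n p hp).wall x.1 i = 0
      change coord n x.1 = y at hx
      rw [wall_eq_zero_iff, hx]
      have hne : ∀ i' ∈ T, (i' : ℕ) ≠ i := fun i' hi' h => hi (Fin.ext h ▸ hi')
      split_ifs with h0
      · refine Finset.sum_eq_zero fun i' hi' => if_neg fun hle => hne i' hi' ?_
        have : (i' : ℕ) ≤ i := hle
        omega
      · refine Finset.sum_congr rfl fun i' hi' => ?_
        have h1 := hne i' hi'
        have : i' ≤ pred i ↔ i' ≤ i := by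
          rw [Fin.le_def, Fin.le_def, val_pred]
          omega
        simp only [this]
    · rw [thetaEquiv_apply, thetaToJoin_mk]
      ext1
      · funext k
        rw [toJoin_wt hg, hx, hzy]
      · funext k
        rw [toJoin_pt hg, hx, ← hzy]
        by_cases h0 : z.wt k = 0
        · rw [if_pos h0, (z.pt_eq_none k).2 h0]
        · rw [if_neg h0]
          have hk : z.pt k ≠ none := fun h => h0 ((z.pt_eq_none k).1 h)
          have hk' := (hzc k).resolve_left hk
          rw [hk', vertexCell, if_pos]
          by_contra h
          exact hk (hk'.trans (if_neg h))

/-- In a flag of cells, a coordinate that occurs in at least as many cells as another one occurs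
in every cell in which the other one occurs. -/
theorem ne_none_of_card_le {F : Finset (Fin n → Option (PointSet p))}
    (hF : ∀ c ∈ F, ∀ c' ∈ F, IsFaceOf c c' ∨ IsFaceOf c' c) {k k' : Fin n}
    (h : (F.filter fun c => c k ≠ none).card ≤ (F.filter fun c => c k' ≠ none).card)
    {c : Fin n → Option (PointSet p)} (hc : c ∈ F) (hck : c k ≠ none) : c k' ≠ none := by
  intro hck'
  refine absurd h (not_le.2 (Finset.card_lt_card ?_))
  rw [Finset.ssubset_iff_of_subset]
  · refine ⟨c, Finset.mem_filter.2 ⟨hc, hck⟩, fun h' => (Finset.mem_filter.1 h').2 hck'⟩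
  · intro c' hc'
    obtain ⟨hc'F, hc'k⟩ := Finset.mem_filter.1 hc'
    refine Finset.mem_filter.2 ⟨hc'F, fun h0 => ?_⟩
    rcases hF c hc c' hc'F with h1 | h1
    · rcases h1 k with h2 | h2
      · exact hck h2
      · exact hck (h2.trans h0)
    · rcases h1 k' with h2 | h2
      · exact hc'k h2
      · exact hc'k (h2.trans hck')

theorem isFace_iff (A : Set (diagramB n p hp).ThetaHat) :
    (diagramB n p hp).IsFace A ↔ IsBarySimplex (thetaEquiv n p hp '' A) := by
  classical
  constructor
  · rintro ⟨g, T, hT, rfl⟩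
    obtain ⟨τ, ε, hg⟩ := exists_act_eq g
    obtain ⟨T, rfl⟩ : ∃ T' : Finset (Fin n), (T' : Set (Fin n)) = T :=
      ⟨T.toFinite.toFinset, by simp⟩
    rw [Finset.coe_nonempty] at hT
    refine ⟨_, ?_, ?_, ?_, image_face hg hT⟩
    · obtain ⟨i, hi⟩ := hT
      exact ⟨_, Finset.mem_image_of_mem _ hi⟩
    · intro c hc
      obtain ⟨i, _, rfl⟩ := Finset.mem_image.1 hc
      exact supp_vertexCell_nonempty τ ε i
    · intro c hc c' hc'
      obtain ⟨i, _, rfl⟩ := Finset.mem_image.1 hc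
      obtain ⟨j, _, rfl⟩ := Finset.mem_image.1 hc'
      exact (le_total j i).imp (vertexCell_isFaceOf τ ε) (vertexCell_isFaceOf τ ε)
  · rintro ⟨F, hne, hsupp, hchain, hA⟩
    -- Sort the coordinates by the number of cells of the flag in which they occur.
    set N : Fin n → ℕ := fun k => (F.filter fun c => c k ≠ none).card with hN
    set τ : Equiv.Perm (Fin n) := (Tuple.sort N).symm with hτ
    have hmono : ∀ k k', τ k ≤ τ k' → N k ≤ N k' := fun k k' h => by
      have := Tuple.monotone_sort N h
      simpa [hτ] using this
    have hpt : ∀ k, ∃ a : PointSet p, ∀ c ∈ F, c k = none ∨ c k = some a := by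
      intro k
      by_cases hk : ∃ c ∈ F, c k ≠ none
      · obtain ⟨c, hc, hck⟩ := hk
        obtain ⟨a, ha⟩ := Option.ne_none_iff_exists'.1 hck
        refine ⟨a, fun c' hc' => ?_⟩
        rcases hchain c hc c' hc' with h | h
        · right
          rw [← (h k).resolve_left hck, ha]
        · exact (h k).imp_right fun h' => h'.trans ha
      · push Not at hk
        exact ⟨basePt hp, fun c hc => Or.inl (hk c hc)⟩
    choose a ha using hpt
    obtain ⟨g, ε, hε, hg⟩ := exists_act_of_perm (hp := hp) τ (fun _ => basePt hp) a
    set T : Finset (Fin n) := Finset.univ.filter fun i => vertexCell hp τ ε i ∈ F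
    have hFT : F = T.image (vertexCell hp τ ε) := by
      ext c
      constructor
      · intro hc
        have hne' : ((supp c).image τ).Nonempty := (hsupp c hc).image τ
        obtain ⟨k₀, hk₀, hmin⟩ := Finset.mem_image.1 (Finset.min'_mem _ hne')
        have hck₀ : c k₀ ≠ none := (Finset.mem_filter.1 hk₀).2
        have e : vertexCell hp τ ε (((supp c).image τ).min' hne') = c := by
          funext k
          by_cases hk : c k = none
          · rw [hk, vertexCell_eq_none, ← hmin]
            exact fun hle => ne_none_of_card_le hchain (hmono _ _ hle) hc hck₀ hk
          · rw [vertexCell, if_pos, hε, (ha k c hc).resolve_left hk]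
            exact Finset.min'_le _ _ (Finset.mem_image_of_mem _
              (Finset.mem_filter.2 ⟨Finset.mem_univ k, hk⟩))
        refine Finset.mem_image.2 ⟨_, Finset.mem_filter.2 ⟨Finset.mem_univ _, ?_⟩, e⟩
        rwa [e]
      · intro hc
        obtain ⟨i, hi, rfl⟩ := Finset.mem_image.1 hc
        exact (Finset.mem_filter.1 hi).2
    have hT : T.Nonempty := by
      obtain ⟨c, hc⟩ := hne
      rw [hFT] at hc
      obtain ⟨i, hi, _⟩ := Finset.mem_image.1 hc
      exact ⟨i, hi⟩
    refine ⟨g, T, hT, ?_⟩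
    have e := image_face hg hT
    rw [← hFT, ← hA] at e
    exact (thetaEquiv n p hp).injective.image_injective e.symm

end MonomialAction

namespace MonomialAction

open SphericalJoin InnerProductGeometry

variable {n p : ℕ} {hp : 2 ≤ p}

/-! ### Strings in `Θ̂` -/

theorem joinCos_of_mem_chamber {z w : (diagramB n p hp).ThetaHat}
    {g : (diagramB n p hp).ShephardGroup} (hz : z ∈ (diagramB n p hp).chamber g)
    (hw : w ∈ (diagramB n p hp).chamber g) :
    joinCos (thetaEquiv n p hp z) (thetaEquiv n p hp w) =
      (diagramB n p hp).cosForm z.1.1 w.1.1 := by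
  obtain ⟨τ, ε, hg⟩ := exists_act_eq g
  rw [thetaEquiv_apply, thetaEquiv_apply, thetaToJoin_of_mem_chamber hz,
    thetaToJoin_of_mem_chamber hw, cosForm_eq, joinCos,
    ← Equiv.sum_comp τ fun k => coord n z.1.1 k * coord n w.1.1 k]
  refine Finset.sum_congr rfl fun i _ => ?_
  rw [toJoin_wt hg, toJoin_wt hg, toJoin_pt hg, toJoin_pt hg]
  by_cases h1 : ycoord z.1 (τ i) = 0
  · rw [h1, zero_mul, zero_mul]
    exact (mul_eq_zero_of_left h1 _).symm
  by_cases h2 : ycoord w.1 (τ i) = 0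
  · rw [h2, mul_zero, zero_mul]
    exact (mul_eq_zero_of_right _ h2).symm
  rw [if_neg h1, if_neg h2, cosDist_some_self, mul_one]

theorem edist_le_stringLength (hn : n ≠ 1) (k : ℕ) (z : ℕ → (diagramB n p hp).ThetaHat)
    (hz : (diagramB n p hp).IsString k z) :
    edist (thetaEquiv n p hp (z 0)) (thetaEquiv n p hp (z k)) ≤
      (diagramB n p hp).stringLength k z := by
  have hJ := isCAT1_of_ne_one (n := n) hn hp
  induction k with
  | zero => rw [(hJ.edist_eq_zero_iff _ _).2 rfl]; exact zero_le
  | succ k ih =>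
    obtain ⟨g, h1, h2⟩ := hz k (Nat.lt_succ_self k)
    refine (hJ.edist_triangle _ (thetaEquiv n p hp (z k)) _).trans ?_
    rw [ExtendedCoxeterDiagram.stringLength, Finset.sum_range_succ]
    refine add_le_add (ih fun l hl => hz l (hl.trans (Nat.lt_succ_self k))) (le_of_eq ?_)
    rw [edist_eq_arccos hn, joinCos_of_mem_chamber h1 h2]
    rfl

/-- There is a string from `x` to `y` of length at most `r`. -/
def Joined (x y : (diagramB n p hp).ThetaHat) (r : ℝ≥0∞) : Prop :=
  ∃ (k : ℕ) (z : ℕ → (diagramB n p hp).ThetaHat), z 0 = x ∧ z k = y ∧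
    (diagramB n p hp).IsString k z ∧ (diagramB n p hp).stringLength k z ≤ r

theorem Joined.edist_le {x y : (diagramB n p hp).ThetaHat} {r : ℝ≥0∞} (h : Joined x y r) :
    edist x y ≤ r := by
  obtain ⟨k, z, h0, hk, hs, hr⟩ := h
  exact iInf_le_of_le k (iInf_le_of_le z (iInf_le_of_le ⟨h0, hk, hs⟩ hr))

theorem Joined.trans {x y w : (diagramB n p hp).ThetaHat} {r r' : ℝ≥0∞} (h : Joined x y r)
    (h' : Joined y w r') : Joined x w (r + r') := by
  obtain ⟨k, z, h0, hk, hs, hr⟩ := h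
  obtain ⟨k', z', h0', hk', hs', hr'⟩ := h'
  set c : ℕ → (diagramB n p hp).ThetaHat := fun l => if l ≤ k then z l else z' (l - k) with hc
  have c1 : ∀ l, l ≤ k → c l = z l := fun l hl => if_pos hl
  have c2 : ∀ l, c (k + l) = z' l := fun l => by
    rcases Nat.eq_zero_or_pos l with rfl | hl
    · rw [add_zero, c1 k le_rfl, hk, h0']
    · simp only [hc]
      rw [if_neg (by omega), Nat.add_sub_cancel_left]
  refine ⟨k + k', c, by rw [c1 0 (Nat.zero_le k), h0], by rw [c2, hk'], fun l hl => ?_, ?_⟩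
  · by_cases hlk : l < k
    · rw [c1 l hlk.le, c1 (l + 1) hlk]
      exact hs l hlk
    · obtain ⟨j, rfl⟩ := Nat.exists_eq_add_of_le (not_lt.1 hlk)
      rw [c2, add_assoc, c2]
      exact hs' j (by omega)
  · rw [ExtendedCoxeterDiagram.stringLength, Finset.sum_range_add]
    refine add_le_add (le_trans (le_of_eq ?_) hr) (le_trans (le_of_eq ?_) hr')
    · refine Finset.sum_congr rfl fun l hl => ?_
      have hl' : l < k := Finset.mem_range.1 hl
      rw [c1 l hl'.le, c1 (l + 1) hl']
    · refine Finset.sum_congr rfl fun l _ => ?_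
      rw [c2, add_assoc, c2]

theorem joined_of_mem_chamber {z w : (diagramB n p hp).ThetaHat}
    {g : (diagramB n p hp).ShephardGroup} (hz : z ∈ (diagramB n p hp).chamber g)
    (hw : w ∈ (diagramB n p hp).chamber g) :
    Joined z w (ENNReal.ofReal (Real.arccos (joinCos (thetaEquiv n p hp z)
      (thetaEquiv n p hp w)))) := by
  refine ⟨1, fun l => if l = 0 then z else w, rfl, rfl, fun l hl => ?_, ?_⟩
  · obtain rfl : l = 0 := by omega
    exact ⟨g, hz, hw⟩
  · rw [ExtendedCoxeterDiagram.stringLength, Finset.sum_range_one, joinCos_of_mem_chamber hz hw]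
    exact le_rfl

/-! ### Shortest strings in an apartment -/

/-- The functionals `uᵢ + uⱼ` and `uᵢ - uⱼ` on `ℝⁿ`, which define the walls of type `B_n`. The
indices may be equal: `uᵢ + uᵢ` defines the wall `uᵢ = 0`, and `uᵢ - uᵢ` separates no points. -/
def root (r : Fin n × Fin n × Bool) (u : EuclideanSpace ℝ (Fin n)) : ℝ :=
  u r.1 + (if r.2.2 then 1 else -1) * u r.2.1

theorem root_comb (r : Fin n × Fin n × Bool) (α β : ℝ) (u v : EuclideanSpace ℝ (Fin n)) :
    root r (α • u + β • v) = α * root r u + β * root r v := by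
  simp only [root, PiLp.add_apply, PiLp.smul_apply, smul_eq_mul]
  ring

/-- The walls that separate `u` and `v`. -/
def separating (u v : EuclideanSpace ℝ (Fin n)) : Finset (Fin n × Fin n × Bool) :=
  Finset.univ.filter fun r => root r u * root r v < 0

theorem mem_separating {u v : EuclideanSpace ℝ (Fin n)} {r : Fin n × Fin n × Bool} :
    r ∈ separating u v ↔ root r u * root r v < 0 := by
  simp [separating]

theorem abs_le_abs_of_not_separated {u v : EuclideanSpace ℝ (Fin n)} (h : separating u v = ∅)
    {i j : Fin n} (hij : |u i| + |v i| ≤ |u j| + |v j|) : |u i| ≤ |u j| := by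
  have hr : ∀ r, 0 ≤ root r u * root r v := fun r => by
    by_contra hr
    have := mem_separating.2 (not_le.1 hr)
    rw [h] at this
    exact absurd this (Finset.notMem_empty r)
  have h1 := hr (i, j, true)
  have h2 := hr (i, j, false)
  simp only [root, if_true, Bool.false_eq_true, if_false] at h1 h2
  by_contra hlt
  have hu := sq_lt_sq.2 (not_le.1 hlt)
  have hv := sq_lt_sq.2 (show |v i| < |v j| by linarith)
  -- The product of the values of the two functionals is `(uᵢ² - uⱼ²) (vᵢ² - vⱼ²)`.
  have h3 := mul_nonneg h1 h2
  have h4 := mul_pos (sub_pos.2 hu) (sub_pos.2 hv)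
  nlinarith

/-- Points of an apartment that are not separated by a wall lie in a common chamber. -/
theorem exists_common_chamber (a b : Fin n → PointSet p) {u v : EuclideanSpace ℝ (Fin n)}
    (hu : ‖u‖ = 1) (hv : ‖v‖ = 1) (h : separating u v = ∅) :
    ∃ (g : (diagramB n p hp).ShephardGroup),
      (thetaEquiv n p hp).symm (apartment a b u hu) ∈ (diagramB n p hp).chamber g ∧
      (thetaEquiv n p hp).symm (apartment a b v hv) ∈ (diagramB n p hp).chamber g := by
  have h' : separating v u = ∅ := by
    rw [← h]
    unfold separating
    simp only [mul_comm]
  set N : Fin n → ℝ := fun i => |u i| + |v i| with hN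
  have hmono := Tuple.monotone_sort N
  obtain ⟨g, hg⟩ := exists_chamber (hp := hp) (Tuple.sort N)
    fun i => if 0 < u i ∨ 0 < v i then a i else b i
  have hsign : ∀ i, 0 ≤ u i * v i := fun i => by
    by_contra hneg
    have : (i, i, true) ∈ separating u v := by
      rw [mem_separating]
      simp only [root, if_true, one_mul]
      nlinarith
    rw [h] at this
    exact absurd this (Finset.notMem_empty _)
  obtain ⟨x, hx⟩ := hg (apartment a b u hu)
    (fun i j hij => abs_le_abs_of_not_separated h (hmono hij)) fun i => by
      simp only [apartment]
      rcases lt_trichotomy (u i) 0 with h0 | h0 | h0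
      · have : ¬ 0 < v i := fun hv0 => by nlinarith [hsign i]
        simp [h0.ne, h0.not_gt, this]
      · simp [h0]
      · simp [h0.ne', h0]
  obtain ⟨x', hx'⟩ := hg (apartment a b v hv)
    (fun i j hij => abs_le_abs_of_not_separated h' (by
      rw [add_comm, add_comm |v _|]
      exact hmono hij)) fun i => by
      simp only [apartment]
      rcases lt_trichotomy (v i) 0 with h0 | h0 | h0
      · have : ¬ 0 < u i := fun hu0 => by nlinarith [hsign i]
        simp [h0.ne, h0.not_gt, this]
      · simp [h0]
      · simp [h0.ne', h0]
  refine ⟨g, ?_, ?_⟩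
  · have : (thetaEquiv n p hp).symm (apartment a b u hu) = thetaPoint x g := by
      rw [Equiv.symm_apply_eq, ← hx]
      rfl
    rw [this]
    rfl
  · have : (thetaEquiv n p hp).symm (apartment a b v hv) = thetaPoint x' g := by
      rw [Equiv.symm_apply_eq, ← hx']
      rfl
    rw [this]
    rfl

/-- Two points that are not antipodal and are separated by a wall: the segment between them meets
the wall in a point that is separated from each of them by fewer walls. -/
theorem exists_mem_wall_between {u v : EuclideanSpace ℝ (Fin n)} (hu : ‖u‖ = 1) (hv : ‖v‖ = 1)
    (hπ : angle u v ≠ Real.pi) (hne : (separating u v).Nonempty) :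
    ∃ z : EuclideanSpace ℝ (Fin n), ‖z‖ = 1 ∧ angle u v = angle u z + angle z v ∧
      (separating u z).card < (separating u v).card ∧
      (separating z v).card < (separating u v).card := by
  obtain ⟨r, hr⟩ := hne
  have hr' := mem_separating.1 hr
  set α := |root r v| with hα
  set β := |root r u| with hβ
  have hα0 : 0 < α := abs_pos.2 fun h => by rw [h, mul_zero] at hr'; exact lt_irrefl _ hr'
  have hβ0 : 0 < β := abs_pos.2 fun h => by rw [h, zero_mul] at hr'; exact lt_irrefl _ hr'
  set z₀ := α • u + β • v with hz₀
  have hrz : root r z₀ = 0 := by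
    rw [hz₀, root_comb, hα, hβ]
    rcases lt_or_gt_of_ne (left_ne_zero_of_mul hr'.ne) with h | h
    · rw [abs_of_neg h, abs_of_pos (pos_of_mul_neg_right hr' h.le)]
      ring
    · rw [abs_of_pos h, abs_of_neg (neg_of_mul_neg_right hr' h.le)]
      ring
  have hz0 : z₀ ≠ 0 := by
    intro h
    have h1 : α • u = -(β • v) := eq_neg_of_add_eq_zero_left h
    have h2 : α = β := by
      have := congrArg norm h1
      rwa [norm_neg, norm_smul, norm_smul, hu, hv, mul_one, mul_one, Real.norm_of_nonneg hα0.le,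
        Real.norm_of_nonneg hβ0.le] at this
    rw [← h2, ← smul_neg] at h1
    have h3 : u = -v := smul_right_injective _ hα0.ne' h1
    apply hπ
    rw [h3, angle_comm]
    refine angle_self_neg_of_nonzero fun h0 => ?_
    rw [h0, norm_zero] at hv
    exact zero_ne_one hv
  have hc : 0 < ‖z₀‖⁻¹ := inv_pos.2 (norm_pos_iff.2 hz0)
  have hrz' : ∀ s, root s (‖z₀‖⁻¹ • z₀) = ‖z₀‖⁻¹ * (α * root s u + β * root s v) := fun s => by
    have := root_comb s ‖z₀‖⁻¹ 0 z₀ 0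
    rw [smul_zero, add_zero, zero_mul, add_zero] at this
    rw [this, hz₀, root_comb]
  have hr0 : root r (‖z₀‖⁻¹ • z₀) = 0 := by
    rw [hrz', ← root_comb, ← hz₀, hrz, mul_zero]
  refine ⟨‖z₀‖⁻¹ • z₀, ?_, ?_, Finset.card_lt_card ?_, Finset.card_lt_card ?_⟩
  · rw [norm_smul, norm_inv, norm_norm, inv_mul_cancel₀ (norm_ne_zero_iff.2 hz0)]
  · rw [angle_smul_right_of_pos _ _ hc, angle_smul_left_of_pos _ _ hc]
    refine angle_eq_angle_add_add_angle_add_of_mem_span hz0 ?_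
    rw [Submodule.mem_span_pair]
    exact ⟨⟨α, hα0.le⟩, ⟨β, hβ0.le⟩, rfl⟩
  · rw [Finset.ssubset_iff_of_subset]
    · refine ⟨r, hr, fun h => ?_⟩
      rw [mem_separating, hr0, mul_zero] at h
      exact lt_irrefl _ h
    · intro s hs
      rw [mem_separating, hrz'] at hs
      rw [mem_separating]
      by_contra hge
      have h1 : 0 ≤ ‖z₀‖⁻¹ * (α * (root s u * root s u) + β * (root s u * root s v)) :=
        mul_nonneg hc.le (add_nonneg (mul_nonneg hα0.le (mul_self_nonneg _))
          (mul_nonneg hβ0.le (not_lt.1 hge)))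
      linarith
  · rw [Finset.ssubset_iff_of_subset]
    · refine ⟨r, hr, fun h => ?_⟩
      rw [mem_separating, hr0, zero_mul] at h
      exact lt_irrefl _ h
    · intro s hs
      rw [mem_separating, hrz'] at hs
      rw [mem_separating]
      by_contra hge
      have h1 : 0 ≤ ‖z₀‖⁻¹ * (α * (root s u * root s v) + β * (root s v * root s v)) :=
        mul_nonneg hc.le (add_nonneg (mul_nonneg hα0.le (not_lt.1 hge))
          (mul_nonneg hβ0.le (mul_self_nonneg _)))
      linarith

theorem joined_apartment_of_ne_pi {a b : Fin n → PointSet p} (hab : ∀ i, a i ≠ b i) (N : ℕ) :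
    ∀ {u v : EuclideanSpace ℝ (Fin n)} (hu : ‖u‖ = 1) (hv : ‖v‖ = 1),
      angle u v ≠ Real.pi → (separating u v).card ≤ N →
      Joined ((thetaEquiv n p hp).symm (apartment a b u hu))
        ((thetaEquiv n p hp).symm (apartment a b v hv)) (ENNReal.ofReal (angle u v)) := by
  induction N with
  | zero =>
    intro u v hu hv _ hN
    have hempty : separating u v = ∅ := Finset.card_eq_zero.1 (Nat.le_zero.1 hN)
    obtain ⟨g, h1, h2⟩ := exists_common_chamber (hp := hp) a b hu hv hempty
    have := joined_of_mem_chamber h1 h2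
    rwa [Equiv.apply_symm_apply, Equiv.apply_symm_apply, joinCos_apartment hab hu hv,
      ← angle_eq_arccos_inner hu hv] at this
  | succ N ih =>
    intro u v hu hv hπ hN
    rcases (separating u v).eq_empty_or_nonempty with h0 | h0
    · exact ih hu hv hπ (by rw [h0, Finset.card_empty]; exact Nat.zero_le _)
    · obtain ⟨z, hz, hadd, h1, h2⟩ := exists_mem_wall_between hu hv hπ h0
      have hlt := lt_of_le_of_ne (angle_le_pi u v) hπ
      rw [hadd, ENNReal.ofReal_add (angle_nonneg _ _) (angle_nonneg _ _)]
      refine (ih hu hz ?_ (by omega)).trans (ih hz hv ?_ (by omega))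
      · linarith [angle_nonneg z v]
      · linarith [angle_nonneg u z]

theorem joined_apartment (hn : 2 ≤ n) {a b : Fin n → PointSet p} (hab : ∀ i, a i ≠ b i)
    {u v : EuclideanSpace ℝ (Fin n)} (hu : ‖u‖ = 1) (hv : ‖v‖ = 1) :
    Joined ((thetaEquiv n p hp).symm (apartment a b u hu))
      ((thetaEquiv n p hp).symm (apartment a b v hv)) (ENNReal.ofReal (angle u v)) := by
  by_cases hπ : angle u v = Real.pi
  swap
  · exact joined_apartment_of_ne_pi hab _ hu hv hπ le_rfl
  -- Antipodal points are joined through a standard basis vector different from both of them.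
  have hi : ∃ i, |u i| < 1 := by
    by_contra hge
    push Not at hge
    have h1 : ∑ i, u i * u i = 1 := by
      rw [← inner_eq_sum, real_inner_self_eq_norm_sq, hu, one_pow]
    have h2 : ∀ i, 1 ≤ u i * u i := fun i => by
      rw [← abs_mul_abs_self]
      nlinarith [hge i]
    have h3 : (n : ℝ) ≤ ∑ i, u i * u i := by
      have := Finset.sum_le_sum fun i (_ : i ∈ Finset.univ) => h2 i
      simpa using this
    have h4 : (2 : ℝ) ≤ n := by exact_mod_cast hn
    linarith
  obtain ⟨i, hi⟩ := hi
  set w : EuclideanSpace ℝ (Fin n) := EuclideanSpace.single i 1 with hw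
  have hw1 : ‖w‖ = 1 := by simp [hw]
  have e1 : angle u w + angle w v = Real.pi := by
    rw [angle_comm w v]
    exact angle_add_angle_eq_pi_of_angle_eq_pi w hπ
  have e2 : angle u w = Real.arccos (u i) := by
    rw [angle_eq_arccos_inner hu hw1, hw]
    congr 1
    simp [EuclideanSpace.inner_single_right]
  have h1 : angle u w ≠ Real.pi := by
    rw [e2, ne_eq, Real.arccos_eq_pi]
    linarith [(abs_lt.1 hi).1]
  have h2 : angle w v ≠ Real.pi := by
    intro h
    have : angle u w = 0 := by linarith
    rw [e2, Real.arccos_eq_zero] at this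
    linarith [(abs_lt.1 hi).2]
  rw [hπ, ← e1, ENNReal.ofReal_add (angle_nonneg _ _) (angle_nonneg _ _)]
  exact (joined_apartment_of_ne_pi hab _ hu hw1 h1 le_rfl).trans
    (joined_apartment_of_ne_pi hab _ hw1 hv h2 le_rfl)

/-! ### The bijection is an isometry -/

theorem edist_thetaEquiv_of_two_le (hn : 2 ≤ n) (x y : (diagramB n p hp).ThetaHat) :
    edist (thetaEquiv n p hp x) (thetaEquiv n p hp y) = edist x y := by
  have hn1 : n ≠ 1 := by omega
  refine le_antisymm ?_ ?_
  · refine le_iInf fun k => le_iInf fun z => le_iInf fun h => ?_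
    obtain ⟨rfl, rfl, hs⟩ := h
    exact edist_le_stringLength hn1 k z hs
  · obtain ⟨a, b, hab, u, v, hu, hv, ex, ey⟩ :=
      exists_apartment hp (thetaEquiv n p hp x) (thetaEquiv n p hp y)
    have h := (joined_apartment (hp := hp) hn hab hu hv).edist_le
    rw [edist_eq_arccos hn1, ex, ey, joinCos_apartment hab hu hv, ← angle_eq_arccos_inner hu hv]
    rwa [← ex, ← ey, Equiv.symm_apply_apply, Equiv.symm_apply_apply] at h

theorem simplex_subsingleton : Subsingleton (diagramB 1 p hp).Simplex := by
  have h : ∀ x : (diagramB 1 p hp).Simplex, ycoord x = fun _ => 1 := fun x => by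
    have h1 := ycoord_sum_sq x
    rw [Fin.sum_univ_one] at h1
    funext i
    rw [Subsingleton.elim i 0]
    exact (sq_eq_sq₀ (ycoord_nonneg x 0) zero_le_one).1 (by rw [h1, one_pow])
  exact ⟨fun x y => ycoord_injective ((h x).trans (h y).symm)⟩

theorem edist_self_theta (x : (diagramB n p hp).ThetaHat) : edist x x = 0 := by
  refine le_antisymm (Joined.edist_le ⟨0, fun _ => x, rfl, rfl, fun l hl => ?_, ?_⟩) zero_le
  · exact absurd hl (Nat.not_lt_zero l)
  · simp [ExtendedCoxeterDiagram.stringLength]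

/-- For `n = 1` the chambers are points, so that all strings are constant. -/
theorem edist_theta_of_ne {x y : (diagramB 1 p hp).ThetaHat} (hxy : x ≠ y) : edist x y = ⊤ := by
  have hsub := simplex_subsingleton (hp := hp)
  have hconst : ∀ (k : ℕ) (z : ℕ → (diagramB 1 p hp).ThetaHat),
      (diagramB 1 p hp).IsString k z → z 0 = z k := by
    intro k z hz
    induction k with
    | zero => rfl
    | succ k ih =>
      rw [ih fun l hl => hz l (hl.trans (Nat.lt_succ_self k))]
      obtain ⟨g, h1, h2⟩ := hz k (Nat.lt_succ_self k)
      apply thetaToJoin_injective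
      rw [thetaToJoin_of_mem_chamber h1, thetaToJoin_of_mem_chamber h2,
        Subsingleton.elim (z k).1 (z (k + 1)).1]
  refine top_le_iff.1 (le_iInf fun k => le_iInf fun z => le_iInf fun h => ?_)
  obtain ⟨h0, hk, hs⟩ := h
  exact absurd (h0.symm.trans ((hconst k z hs).trans hk)) hxy

theorem edist_thetaEquiv_one (x y : (diagramB 1 p hp).ThetaHat) :
    edist (thetaEquiv 1 p hp x) (thetaEquiv 1 p hp y) = edist x y := by
  have hJ : ∀ z w : SphericalJoin 1 (PointSet p), edist z w = optDist (z.pt 0) (w.pt 0) := by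
    intro z w
    change (if 1 = 1 then ⨆ i, optDist (z.pt i) (w.pt i) else _) = _
    rw [if_pos rfl, iSup_unique]
    rfl
  have hwt : ∀ z : SphericalJoin 1 (PointSet p), z.wt 0 = 1 := fun z => by
    have h := z.sum_sq
    rw [Fin.sum_univ_one] at h
    exact (sq_eq_sq₀ (z.wt_nonneg 0) zero_le_one).1 (by rw [h, one_pow])
  have hpt : ∀ z : SphericalJoin 1 (PointSet p), ∃ a, z.pt 0 = some a := fun z => by
    rw [← Option.ne_none_iff_exists', ne_eq, z.pt_eq_none, hwt]
    exact one_ne_zero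
  obtain ⟨a, ha⟩ := hpt (thetaEquiv 1 p hp x)
  obtain ⟨b, hb⟩ := hpt (thetaEquiv 1 p hp y)
  rw [hJ, ha, hb]
  by_cases hxy : x = y
  · subst hxy
    rw [ha, Option.some_inj] at hb
    rw [edist_self_theta, hb]
    exact if_pos rfl
  · rw [edist_theta_of_ne hxy]
    refine if_neg fun hab => hxy ((thetaEquiv 1 p hp).injective ?_)
    ext1
    · funext i
      rw [Subsingleton.elim i 0, hwt, hwt]
    · funext i
      rw [Subsingleton.elim i 0, ha, hb, hab]

end MonomialAction

end

theorem mainTheorem9 (n p : ℕ) (hn : 1 ≤ n) (hp : 2 ≤ p) :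
    (∃ Φ : (diagramB n p hp).ThetaHat ≃ SphericalJoin n (PointSet p),
      (∀ x y, edist (Φ x) (Φ y) = edist x y) ∧
      ∀ A : Set (diagramB n p hp).ThetaHat,
        (diagramB n p hp).IsFace A ↔ SphericalJoin.IsBarySimplex (Φ '' A)) ∧
    IsCAT1 (diagramB n p hp).ThetaHat := by
  rcases Nat.eq_or_lt_of_le hn with rfl | hn2
  · exact ⟨⟨MonomialAction.thetaEquiv 1 p hp, MonomialAction.edist_thetaEquiv_one,
      MonomialAction.isFace_iff⟩,
      isCAT1_of_discrete MonomialAction.edist_self_theta fun _ _ =>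
        MonomialAction.edist_theta_of_ne⟩
  · have hiso := MonomialAction.edist_thetaEquiv_of_two_le (hp := hp) hn2
    exact ⟨⟨MonomialAction.thetaEquiv n p hp, hiso, MonomialAction.isFace_iff⟩,
      IsCAT1.of_equiv _ hiso (SphericalJoin.isCAT1_of_ne_one (by omega) hp)⟩
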